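/- Let $A,B$ be nonnegative random variables on a common probability space with $P(A\in[0,1))=1$, $P(A\neq 0)>0$, $P(B\neq 0)>0$ and $E[\max\{\log B,0\}]<\infty$. Let $\rho>0$ and let $f:(0,\infty)\to(0,\infty)$ be measurable and regularly varying of index $\rho$, i.e. $f(cx)/f(x)\to c^\rho$ as $x\to\infty$ for every $c>0$. With the convention $-\log 0=\infty$, suppose that for every $y\in[0,\infty)$ the limit $$g(y)=\lim_{t\to\infty}\frac{-\log P(Aty+B>t)}{f(t)}\in[0,\infty]$$ exists. For $\lambda\in[0,\infty)$ put $\varphi_\rho(\lambda)=\inf_{y>0}\{y^\rho\lambda+g(y)\}$, and suppose that $g$ is admissible: either $\varphi_\rho(\lambda)>\lambda$ for some $\lambda\in(0,\infty)$, or $g(0)=0$. Let $$\lambda^*=\inf_{y\in(0,1)}\frac{g(y)}{1-y^\rho}\in[0,\infty].$$ Then there is exactly one probability law on $\mathbb R$ of a random variable $X$ such that $X\stackrel{d}{=}AX+B$ with $X$ and $(A,B)$ independent. This $X$ is almost surely nonnegative and satisfies $$\lim_{t\to\infty}\frac{-\log P(X>t)}{f(t)}=\lambda^*.$$ Moreover,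 if $\lambda^*<\infty$, then $\varphi_\rho(\lambda^*)=\lambda^*$, and if $0<\lambda^*<\infty$, then $\lambda^*$ is the unique nonzero fixed point of $\varphi_\rho$ in $[0,\infty)$. -/

import Mathlib

open MeasureTheory Filter Set
open scoped NNReal ENNReal Topology

noncomputable section

namespace Perpetuity

/-- `-log p` for a probability `p`, as an element of `[0, ∞]`; in particular `-log 0 = ∞`. -/
def negLog (p : ℝ≥0∞) : ℝ≥0∞ := (-ENNReal.log p).toENNReal

/-- `f : (0, ∞) → (0, ∞)` is measurable and regularly varying (at infinity) of index `ρ`.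
Only the values of `f` on `(0, ∞)` matter. -/
structure RegularlyVarying (ρ : ℝ) (f : ℝ → ℝ) : Prop where
  measurable : Measurable (fun x : Ioi (0 : ℝ) => f x)
  pos : ∀ x : ℝ, 0 < x → 0 < f x
  ratio : ∀ c : ℝ, 0 < c → Tendsto (fun x : ℝ => f (c * x) / f x) atTop (𝓝 (c ^ ρ))

/-- A real random variable with law `ν` is nonnegative and has an exponential-`f`-decay tail
with rate `l ∈ [0, ∞]`: `-log P(X > t) / f t → l` as `t → ∞`. -/
structure ExpDecay (f : ℝ → ℝ) (ν : Measure ℝ) (l : ℝ≥0∞) : Prop where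
  nonneg : ∀ᵐ x ∂ν, 0 ≤ x
  tail : Tendsto (fun t : ℝ => negLog (ν {x | t < x}) / ENNReal.ofReal (f t)) atTop (𝓝 l)

/-- `g : [0, ∞) → [0, ∞]` is the local dependence measure of the pair `(A, B)` with respect
to `f`: for every `y ≥ 0`, `-log P(A t y + B > t) / f t → g y` as `t → ∞`. -/
def IsLDM {Ω : Type*} [MeasurableSpace Ω] (μ : Measure Ω) (A B : Ω → ℝ) (f : ℝ → ℝ)
    (g : ℝ≥0 → ℝ≥0∞) : Prop :=
  ∀ y : ℝ≥0, Tendsto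
    (fun t : ℝ => negLog (μ {ω | t < A ω * t * (y : ℝ) + B ω}) / ENNReal.ofReal (f t))
    atTop (𝓝 (g y))

/-- The Legendre-type transform `φ_ρ(l) = inf_{y > 0} (y ^ ρ * l + g y)`, for `l ∈ [0, ∞)`. -/
def legendre (ρ : ℝ) (g : ℝ≥0 → ℝ≥0∞) (l : ℝ≥0) : ℝ≥0∞ :=
  ⨅ (y : ℝ≥0) (_ : 0 < y), ENNReal.ofReal ((y : ℝ) ^ ρ) * (l : ℝ≥0∞) + g y

/-- Admissibility: `φ_ρ(l) > l` for some `l ∈ (0, ∞)`, or `g 0 = 0`. -/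
def Admissible (ρ : ℝ) (g : ℝ≥0 → ℝ≥0∞) : Prop :=
  (∃ l : ℝ≥0, 0 < l ∧ (l : ℝ≥0∞) < legendre ρ g l) ∨ g 0 = 0

/-- `λ* = inf_{0 < y < 1} g y / (1 - y ^ ρ)`, an element of `[0, ∞]`. -/
def lambdaStar (ρ : ℝ) (g : ℝ≥0 → ℝ≥0∞) : ℝ≥0∞ :=
  ⨅ (y : ℝ≥0) (_ : 0 < y) (_ : y < 1), g y / ENNReal.ofReal (1 - (y : ℝ) ^ ρ)

/-- `ν` is the law of a solution `X` of `X = A X + B` in distribution, with `X` and `(A, B)`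
independent: if `(X, ω)` has law `ν ⊗ μ`, then `A ω * X + B ω` has law `ν`. -/
def IsPerpetuityLaw {Ω : Type*} [MeasurableSpace Ω] (μ : Measure Ω) (A B : Ω → ℝ)
    (ν : Measure ℝ) : Prop :=
  (ν.prod μ).map (fun p : ℝ × Ω => A p.2 * p.1 + B p.2) = ν

end Perpetuity

end

/-! Existence: iterating `x ↦ A x + B` along an i.i.d. sequence gives the series `∑ A₀⋯Aₙ₋₁Bₙ`. By
the strong law its products decay geometrically while `log⁺ Bₙ = o(n)`, so it converges, and
splitting off the first factor gives the equation in law. Uniqueness: the modulus of the difference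
of two characteristic functions is dominated by its average over `s ↦ A s`, so a maximum principle
forces it to vanish.

Tail: write `F t = P(X > t)`. Independence gives `F t ≥ F (t y) P(A t y + B > t)`. A decay rate `l`
would thus satisfy `l ≤ y^ρ l + g y`, i.e. `l ≤ g y / (1 - y^ρ)` for `y < 1`;
`eventually_exp_le_tail` makes this rigorous by iteration. Conversely, cutting the range of `X / t`
into finitely many cells turns a rate `l` into nearly `φ_ρ(l)`. Below `λ*` each such step gains a
fixed amount, so rates climb to any `l₁ < λ*`. The climb needs a positive start, supplied by some `K
> 1` with `g K > 0`; admissibility provides it unless `λ* = 0`, when nothing is needed.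

Fixed points: `φ_ρ` is a concave nondecreasing infimum of affine functions, at least the identity up
to `λ*` and strictly below it afterwards. A point where `φ_ρ` exceeds the identity excludes other
nonzero fixed points. -/

namespace Perpetuity

/-! ### Regular variation of positive index forces divergence -/

/-- The uniform convergence theorem for slowly varying functions, in additive form. -/
theorem uniform_of_additive_slow {k : ℝ → ℝ} (hk : Measurable k)
    (h : ∀ u : ℝ, Tendsto (fun x => k (x + u) - k x) atTop (𝓝 0)) :
    ∃ X : ℝ, ∀ x, X ≤ x → ∀ u ∈ Icc (0 : ℝ) 1, |k (x + u) - k x| ≤ 1 := by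
  by_contra! hcon
  choose x hx u hu hbad using fun n : ℕ => hcon n
  have hxt : Tendsto x atTop atTop := tendsto_atTop_mono hx tendsto_natCast_atTop_atTop
  have hxut : Tendsto (fun n => x n + u n) atTop atTop :=
    tendsto_atTop_mono (fun n => by linarith [(hu n).1]) hxt
  have key : ∀ z : ℕ → ℝ, Tendsto z atTop atTop →
      Tendsto (fun n => volume.restrict (Icc (0 : ℝ) 3) {v | (1 / 2 : ℝ) ≤ |k (z n + v) - k (z n)|})
        atTop (𝓝 0) := by
    intro z hz
    have h1 : TendstoInMeasure (volume.restrict (Icc (0 : ℝ) 3))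
        (fun n v => k (z n + v) - k (z n)) atTop (fun _ => (0 : ℝ)) := by
      refine tendstoInMeasure_of_tendsto_ae (fun n => ?_) (ae_of_all _ fun v => (h v).comp hz)
      exact ((hk.comp (measurable_const_add _)).sub_const _).aestronglyMeasurable
    have h2 := tendstoInMeasure_iff_norm.1 h1 (1 / 2) (by norm_num)
    simpa using h2
  have e1 := (key x hxt).eventually (gt_mem_nhds (show (0 : ℝ≥0∞) < 1 by simp))
  have e2 := (key _ hxut).eventually (gt_mem_nhds (show (0 : ℝ≥0∞) < 1 by simp))
  obtain ⟨n, h1, h2⟩ := (e1.and e2).exists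
  -- `V` and the translate of `W` each have measure below 1, so they cannot cover `[1, 3]`. For `v`
  -- in that interval, `u n ∈ [0, 1]` keeps `v - u n` in `[0, 3]`. A point outside both sets links
  -- `x n` to `x n + u n` through two increments below 1/2.
  set V := {v | (1 / 2 : ℝ) ≤ |k (x n + v) - k (x n)|} ∩ Icc (0 : ℝ) 3 with hV
  set W := {v | (1 / 2 : ℝ) ≤ |k (x n + u n + v) - k (x n + u n)|} ∩ Icc (0 : ℝ) 3 with hW
  rw [Measure.restrict_apply' measurableSet_Icc] at h1 h2
  have hW' : volume ((fun v => v - u n) ⁻¹' W) < 1 := by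
    simp only [sub_eq_add_neg, measure_preimage_add_right]; exact h2
  have hlt : volume (V ∪ (fun v => v - u n) ⁻¹' W) < volume (Icc (1 : ℝ) 3) := by
    calc _ ≤ volume V + volume ((fun v => v - u n) ⁻¹' W) := measure_union_le _ _
      _ < 1 + 1 := ENNReal.add_lt_add h1 hW'
      _ = volume (Icc (1 : ℝ) 3) := by
        rw [Real.volume_Icc]; norm_num
  obtain ⟨v, hv, hvn⟩ : ∃ v ∈ Icc (1 : ℝ) 3, v ∉ V ∪ (fun v => v - u n) ⁻¹' W := by
    by_contra! hc
    exact absurd (measure_mono hc) (not_le.2 hlt)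
  have hu1 := (hu n).1
  have hu2 := (hu n).2
  have a1 : |k (x n + v) - k (x n)| < 1 / 2 := by
    by_contra! hc
    exact hvn (Or.inl ⟨hc, by linarith [hv.1], hv.2⟩)
  have a2 : |k (x n + u n + (v - u n)) - k (x n + u n)| < 1 / 2 := by
    by_contra! hc
    exact hvn (Or.inr ⟨hc, by show 0 ≤ v - u n; linarith [hv.1], by
      show v - u n ≤ 3; linarith [hv.2]⟩)
  rw [show x n + u n + (v - u n) = x n + v by ring] at a2
  have := hbad n
  rw [abs_lt] at a1 a2
  rcases lt_abs.1 this with h | h <;> linarith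

/-- In logarithmic coordinates unit increments are eventually at least `ρ / 2`, and the uniform
convergence theorem controls the starting values over a unit interval; together they give linear
growth of `log f (exp x)`. -/
theorem RegularlyVarying.tendsto_atTop {ρ : ℝ} (hρ : 0 < ρ) {f : ℝ → ℝ}
    (hf : RegularlyVarying ρ f) : Tendsto f atTop atTop := by
  set m : ℝ → ℝ := fun x => Real.log (f (Real.exp x)) with hm
  have hmm : Measurable m := by
    refine Real.measurable_log.comp ?_
    exact hf.measurable.comp
      (Real.measurable_exp.subtype_mk (h := fun x => (Real.exp_pos x : Real.exp x ∈ Ioi (0 : ℝ))))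
  have hlim : ∀ u : ℝ, Tendsto (fun x => m (x + u) - m x) atTop (𝓝 (ρ * u)) := by
    intro u
    have h1 := ((hf.ratio (Real.exp u) (Real.exp_pos u)).comp Real.tendsto_exp_atTop).log
      (by positivity)
    have h2 : Real.log (Real.exp u ^ ρ) = ρ * u := by
      rw [Real.log_rpow (Real.exp_pos u), Real.log_exp]
    rw [h2] at h1
    refine h1.congr fun x => ?_
    simp only [Function.comp, hm]
    rw [Real.log_div (hf.pos _ (by positivity)).ne' (hf.pos _ (by positivity)).ne',
      Real.exp_add, mul_comm]
  obtain ⟨X, hX⟩ := uniform_of_additive_slow (k := fun x => m x - ρ * x)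
    (hmm.sub (measurable_id.const_mul ρ)) (fun u => by
      have := (hlim u).sub_const (ρ * u)
      rw [sub_self] at this
      exact this.congr fun x => by ring)
  obtain ⟨Y, hY⟩ := eventually_atTop.1
    ((hlim 1).eventually (lt_mem_nhds (show ρ / 2 < ρ * 1 by linarith)))
  set Z := max X Y
  have hstep : ∀ n : ℕ, ∀ u ∈ Icc (0 : ℝ) 1, m Z - 1 + n * (ρ / 2) ≤ m (Z + u + n) := by
    intro n u hu
    induction n with
    | zero =>
      have := (abs_le.1 (hX Z (le_max_left _ _) u hu)).1
      have h0 : 0 ≤ ρ * u := mul_nonneg hρ.le hu.1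
      simp only [Nat.cast_zero, zero_mul, add_zero]
      linarith
    | succ n ih =>
      have h1 := hY (Z + u + n) (by
        have : Y ≤ Z := le_max_right _ _
        have : (0 : ℝ) ≤ n := Nat.cast_nonneg n
        linarith [hu.1])
      push_cast
      rw [← add_assoc]
      linarith
  have hmt : Tendsto m atTop atTop := by
    have hlow : ∀ x, Z ≤ x → m Z - 1 + (x - Z - 1) * (ρ / 2) ≤ m x := by
      intro x hx
      have h0 : 0 ≤ x - Z := by linarith
      have hfl := Nat.floor_le h0
      have hfl' := Nat.lt_floor_add_one (x - Z)
      have := hstep ⌊x - Z⌋₊ (x - Z - ⌊x - Z⌋₊) ⟨by linarith, by linarith⟩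
      rw [show Z + (x - Z - (⌊x - Z⌋₊ : ℝ)) + ⌊x - Z⌋₊ = x by ring] at this
      have h2 : (x - Z - 1) * (ρ / 2) ≤ ⌊x - Z⌋₊ * (ρ / 2) := by gcongr; linarith
      linarith
    refine tendsto_atTop_mono' atTop ((eventually_ge_atTop Z).mono hlow) ?_
    refine tendsto_atTop_add_const_left _ _ (Tendsto.atTop_mul_const (by positivity) ?_)
    simp only [sub_eq_add_neg]
    exact tendsto_atTop_add_const_right _ _ (tendsto_atTop_add_const_right _ _ tendsto_id)
  have h3 := Real.tendsto_exp_atTop.comp (hmt.comp Real.tendsto_log_atTop)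
  refine h3.congr' ?_
  filter_upwards [eventually_gt_atTop 0] with t ht
  simp only [Function.comp, hm]
  rw [Real.exp_log ht, Real.exp_log (hf.pos t ht)]

/-! ### Uniqueness of the law -/

theorem integral_lt_of_ae_lt {Ω : Type*} [MeasurableSpace Ω] {μ : Measure Ω}
    [IsProbabilityMeasure μ] {h : Ω → ℝ} (hi : Integrable h μ) {c : ℝ} (hlt : ∀ᵐ ω ∂μ, h ω < c) :
    ∫ ω, h ω ∂μ < c := by
  have h1 : 0 < ∫ ω, (c - h ω) ∂μ := by
    rw [integral_pos_iff_support_of_nonneg_ae (hlt.mono fun ω hω => (sub_pos.2 hω).le)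
      ((integrable_const c).sub hi)]
    have : Function.support (fun ω => c - h ω) =ᵐ[μ] univ := by
      filter_upwards [hlt] with ω hω
      exact propext ⟨fun _ => trivial, fun _ => (sub_pos.2 hω).ne'⟩
    rw [measure_congr this]
    simp
  rw [integral_sub (integrable_const c) hi] at h1
  simp only [integral_const, probReal_univ, smul_eq_mul, one_mul] at h1
  linarith

/-- A maximum principle: a bounded continuous function dominated by its averages over random
contractions, and vanishing at the origin, is nonpositive. -/
theorem nonpos_of_le_integral_contraction {Ω : Type*} [MeasurableSpace Ω] {μ : Measure Ω}
    [IsProbabilityMeasure μ] {A : Ω → ℝ} (hA : Measurable A)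
    (hA01 : ∀ᵐ ω ∂μ, 0 ≤ A ω ∧ A ω < 1) {D : ℝ → ℝ} (hD : Continuous D) (hD0 : D 0 = 0)
    {C : ℝ} (hC : ∀ s, |D s| ≤ C) (hle : ∀ s, D s ≤ ∫ ω, D (A ω * s) ∂μ) {s : ℝ} (hs : 0 ≤ s) :
    D s ≤ 0 := by
  obtain ⟨v, hv, hvmax⟩ := isCompact_Icc.exists_isMaxOn (nonempty_Icc.2 hs) hD.continuousOn
  have hcpt : IsCompact (Icc 0 s ∩ D ⁻¹' {D v}) :=
    isCompact_Icc.inter_right (isClosed_singleton.preimage hD)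
  -- `u` is the smallest maximiser on `[0, s]`. If the maximum is positive then `u > 0`, so `A u <
  -- u` makes `D (A u) < D u` almost surely, contradicting the averaging bound.
  obtain ⟨u, ⟨hu, huv⟩, hmin⟩ := hcpt.exists_isLeast ⟨v, hv, rfl⟩
  have huv' : D u = D v := huv
  by_contra! hpos
  have hupos : 0 < D u := by rw [huv']; exact hpos.trans_le (hvmax ⟨hs, le_rfl⟩)
  have hu0 : 0 < u := by
    refine lt_of_le_of_ne hu.1 fun h => ?_
    rw [← h, hD0] at hupos
    exact lt_irrefl _ hupos
  have hint : Integrable (fun ω => D (A ω * u)) μ :=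
    Integrable.of_bound (hD.measurable.comp (hA.mul_const u)).aestronglyMeasurable C
      (ae_of_all _ fun ω => hC _)
  refine absurd (hle u) (not_le.2 (integral_lt_of_ae_lt hint ?_))
  filter_upwards [hA01] with ω hω
  have h1 : A ω * u < u := by nlinarith
  have hmem : A ω * u ∈ Icc 0 s := ⟨mul_nonneg hω.1 hu0.le, h1.le.trans hu.2⟩
  refine lt_of_le_of_ne (by rw [huv']; exact hvmax hmem) fun h => ?_
  exact absurd (hmin ⟨hmem, h.trans huv'⟩) (not_le.2 h1)

theorem charFun_continuous (ν : Measure ℝ) [IsFiniteMeasure ν] : Continuous (charFun ν) := by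
  have : charFun ν = fun t : ℝ => ∫ x, Complex.exp (t * x * Complex.I) ∂ν := by
    ext t; exact charFun_apply_real t
  rw [this]
  refine continuous_of_dominated (bound := fun _ => 1) (fun t => ?_) (fun t => ?_)
    (integrable_const _) (ae_of_all _ fun x => ?_)
  · exact (by fun_prop : Continuous fun x : ℝ => Complex.exp (t * x * Complex.I)).aestronglyMeasurable
  · refine ae_of_all _ fun x => le_of_eq ?_
    rw [← Complex.ofReal_mul, Complex.norm_exp_ofReal_mul_I]
  · fun_prop

theorem IsPerpetuityLaw.charFun_eq {Ω : Type*} [MeasurableSpace Ω] {μ : Measure Ω}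
    [IsProbabilityMeasure μ] {A B : Ω → ℝ} (hA : Measurable A) (hB : Measurable B)
    {ν : Measure ℝ} [IsProbabilityMeasure ν] (h : IsPerpetuityLaw μ A B ν) (s : ℝ) :
    charFun ν s = ∫ ω, Complex.exp (s * B ω * Complex.I) * charFun ν (A ω * s) ∂μ := by
  have hm : Measurable (fun p : ℝ × Ω => A p.2 * p.1 + B p.2) := by fun_prop
  have hcont : Continuous fun x : ℝ => Complex.exp (s * x * Complex.I) := by fun_prop
  have hint : Integrable
      (fun p : ℝ × Ω => Complex.exp (s * ((A p.2 * p.1 + B p.2 : ℝ) : ℂ) * Complex.I))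
      (ν.prod μ) := by
    refine Integrable.of_bound (hcont.measurable.comp hm).aestronglyMeasurable 1
      (ae_of_all _ fun p => le_of_eq ?_)
    rw [← Complex.ofReal_mul, Complex.norm_exp_ofReal_mul_I]
  conv_lhs => rw [← h, charFun_apply_real]
  rw [integral_map hm.aemeasurable hcont.aestronglyMeasurable, integral_prod_symm _ hint]
  refine integral_congr_ae (ae_of_all _ fun ω => ?_)
  simp only
  rw [charFun_apply_real, ← integral_const_mul]
  refine integral_congr_ae (ae_of_all _ fun x => ?_)
  simp only
  rw [← Complex.exp_add]
  congr 1
  push_cast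
  ring

theorem IsPerpetuityLaw.unique {Ω : Type*} [MeasurableSpace Ω] {μ : Measure Ω}
    [IsProbabilityMeasure μ] {A B : Ω → ℝ} (hA : Measurable A) (hB : Measurable B)
    (hA01 : ∀ᵐ ω ∂μ, 0 ≤ A ω ∧ A ω < 1)
    {ν ν' : Measure ℝ} [IsProbabilityMeasure ν] [IsProbabilityMeasure ν']
    (h : IsPerpetuityLaw μ A B ν) (h' : IsPerpetuityLaw μ A B ν') : ν = ν' := by
  set D : ℝ → ℝ := fun s => ‖charFun ν s - charFun ν' s‖ with hD
  have hDc : Continuous D := ((charFun_continuous ν).sub (charFun_continuous ν')).norm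
  have hD0 : D 0 = 0 := by simp [hD]
  have hDb : ∀ s, |D s| ≤ 2 := fun s => by
    rw [abs_of_nonneg (norm_nonneg _)]
    refine (norm_sub_le _ _).trans ?_
    linarith [norm_charFun_le_one (μ := ν) s, norm_charFun_le_one (μ := ν') s]
  have hDle : ∀ s, D s ≤ ∫ ω, D (A ω * s) ∂μ := by
    have hi : ∀ (ν : Measure ℝ) [IsProbabilityMeasure ν] (s : ℝ), Integrable
        (fun ω => Complex.exp (s * B ω * Complex.I) * charFun ν (A ω * s)) μ := by
      intro ν _ s
      refine Integrable.of_bound ?_ 1 (ae_of_all _ fun ω => ?_)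
      · have h1 : Measurable fun ω => charFun ν (A ω * s) :=
          (charFun_continuous ν).measurable.comp (hA.mul_const s)
        have h2 : Measurable fun ω => Complex.exp (s * B ω * Complex.I) := by fun_prop
        exact (h2.mul h1).aestronglyMeasurable
      · rw [norm_mul, ← Complex.ofReal_mul, Complex.norm_exp_ofReal_mul_I, one_mul]
        exact norm_charFun_le_one _
    intro s
    have e : charFun ν s - charFun ν' s = ∫ ω, Complex.exp (s * B ω * Complex.I) *
        (charFun ν (A ω * s) - charFun ν' (A ω * s)) ∂μ := by
      rw [h.charFun_eq hA hB, h'.charFun_eq hA hB, ← integral_sub (hi ν s) (hi ν' s)]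
      simp only [mul_sub]
    simp only [hD]
    rw [e]
    refine (norm_integral_le_integral_norm _).trans (le_of_eq ?_)
    refine integral_congr_ae (ae_of_all _ fun ω => ?_)
    simp only
    rw [norm_mul, ← Complex.ofReal_mul, Complex.norm_exp_ofReal_mul_I, one_mul]
  have hpos : ∀ s, D s ≤ 0 := by
    intro s
    rcases le_total 0 s with hs | hs
    · exact nonpos_of_le_integral_contraction hA hA01 hDc hD0 hDb hDle hs
    · have := nonpos_of_le_integral_contraction (D := fun s => D (-s)) (s := -s) hA hA01
        (hDc.comp continuous_neg) (by simpa using hD0) (fun s => hDb _)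
        (fun s => by simpa using hDle (-s)) (by linarith)
      simpa using this
  refine Measure.ext_of_charFun (funext fun s => ?_)
  exact sub_eq_zero.1 (norm_le_zero_iff.1 (hpos s))

/-! ### Existence by the perpetuity series -/

/-- Prepending a coordinate to a sequence. -/
def seqCons {Ω : Type*} (p : Ω × (ℕ → Ω)) (n : ℕ) : Ω := Nat.casesOn n p.1 p.2

@[simp] theorem seqCons_zero {Ω : Type*} (p : Ω × (ℕ → Ω)) : seqCons p 0 = p.1 := rfl

@[simp] theorem seqCons_succ {Ω : Type*} (p : Ω × (ℕ → Ω)) (n : ℕ) : seqCons p (n + 1) = p.2 n :=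
  rfl

theorem measurable_seqCons {Ω : Type*} [MeasurableSpace Ω] :
    Measurable (seqCons : Ω × (ℕ → Ω) → ℕ → Ω) := by
  refine measurable_pi_iff.2 fun n => ?_
  cases n with
  | zero => exact measurable_fst
  | succ n => exact (measurable_pi_apply n).comp measurable_snd

/-- This invariance under prepending an independent copy turns the pathwise recursion
`perpetuitySeries_seqCons` into the equation in law. -/
theorem map_seqCons {Ω : Type*} [MeasurableSpace Ω] (μ : Measure Ω) [IsProbabilityMeasure μ] :
    (μ.prod (Measure.infinitePi fun _ : ℕ => μ)).map seqCons = Measure.infinitePi fun _ : ℕ => μ := by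
  refine Measure.eq_infinitePi _ fun s t ht => ?_
  set N := s.sup id + 1
  -- enlarge the box to an initial segment
  have key : ∀ (N : ℕ) (t : ℕ → Set Ω), (∀ i, MeasurableSet (t i)) →
      (μ.prod (Measure.infinitePi fun _ : ℕ => μ)).map seqCons
        (Set.pi (Finset.range (N + 1)) t) = ∏ i ∈ Finset.range (N + 1), μ (t i) := by
    intro N t ht
    rw [Measure.map_apply measurable_seqCons
      (MeasurableSet.pi (Finset.countable_toSet _) fun i _ => ht i)]
    have : seqCons ⁻¹' (Set.pi (Finset.range (N + 1)) t) =
        t 0 ×ˢ Set.pi (Finset.range N) (fun i => t (i + 1)) := by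
      ext ⟨a, w⟩
      simp only [mem_preimage, Set.mem_pi, Finset.coe_range, mem_Iio, mem_prod]
      constructor
      · exact fun h => ⟨h 0 (by omega), fun i hi => h (i + 1) (by omega)⟩
      · rintro ⟨h0, h1⟩ i hi
        cases i with
        | zero => exact h0
        | succ i => exact h1 i (by omega)
    rw [this, Measure.prod_prod, Measure.infinitePi_pi _ (fun i _ => ht _), Finset.prod_range_succ',
      mul_comm]
  classical
  have hs : Set.pi s t = Set.pi (Finset.range (N + 1)) (fun i => if i ∈ s then t i else univ) := by
    ext w
    simp only [Set.mem_pi, Finset.mem_coe, Finset.mem_range]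
    constructor
    · intro h i _
      by_cases hi : i ∈ s
      · simpa [hi] using h i hi
      · simp [hi]
    · intro h i hi
      have := h i (by have := Finset.le_sup (f := id) hi; simp only [id] at this; omega)
      simpa [hi] using this
  rw [hs, key N _ (fun i => by split_ifs; exacts [ht i, .univ])]
  symm
  refine Finset.prod_subset_one_on_sdiff (fun i hi => ?_) (fun i hi => ?_) (fun i hi => ?_)
  · have := Finset.le_sup (f := id) hi
    simp only [id] at this
    exact Finset.mem_range.2 (by omega)
  · simp [(Finset.mem_sdiff.1 hi).2]
  · simp [hi]

/-- The strong law of large numbers for functions of independent coordinates. -/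
theorem strong_law_infinitePi {Ω : Type*} [MeasurableSpace Ω] {μ : Measure Ω}
    [IsProbabilityMeasure μ] {h : Ω → ℝ} (hm : Measurable h) (hi : Integrable h μ) :
    ∀ᵐ w ∂(Measure.infinitePi fun _ : ℕ => μ),
      Tendsto (fun n : ℕ => (∑ i ∈ Finset.range n, h (w i)) / n) atTop (𝓝 (∫ ω, h ω ∂μ)) := by
  have hmp : ∀ i : ℕ, MeasurePreserving (fun w : ℕ → Ω => w i) (Measure.infinitePi fun _ : ℕ => μ) μ :=
    fun i => measurePreserving_eval_infinitePi (fun _ : ℕ => μ) i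
  have hind := ProbabilityTheory.iIndepFun_infinitePi (P := fun _ : ℕ => μ)
    (X := fun _ => h) (fun _ => hm)
  have := ProbabilityTheory.strong_law_ae_real (μ := Measure.infinitePi fun _ : ℕ => μ)
    (fun i w => h (w i)) ((hmp 0).integrable_comp_of_integrable hi)
    (fun i j hij => hind.indepFun hij)
    (fun i => ⟨(hm.comp (measurable_pi_apply i)).aemeasurable,
      (hm.comp (measurable_pi_apply 0)).aemeasurable, by
        have e : ∀ i : ℕ, Measure.map (fun w : ℕ → Ω => h (w i)) (Measure.infinitePi fun _ : ℕ => μ)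
            = μ.map h := fun i => by
          conv_rhs => rw [← (hmp i).map_eq, Measure.map_map hm (measurable_pi_apply i)]
          rfl
        rw [e, e]⟩)
  have e : ∫ w, h (w 0) ∂(Measure.infinitePi fun _ : ℕ => μ) = ∫ ω, h ω ∂μ := by
    rw [← (hmp 0).map_eq, integral_map (measurable_pi_apply 0).aemeasurable]
    · rw [(hmp 0).map_eq]
    · exact hm.aestronglyMeasurable
  rwa [e] at this

theorem tendsto_div_of_tendsto_sum_div {b : ℕ → ℝ} {m : ℝ}
    (h : Tendsto (fun n : ℕ => (∑ i ∈ Finset.range n, b i) / n) atTop (𝓝 m)) :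
    Tendsto (fun n : ℕ => b n / n) atTop (𝓝 0) := by
  have h1 := (tendsto_add_atTop_iff_nat 1).2 h
  have h2 : Tendsto (fun n : ℕ => ((n + 1 : ℕ) : ℝ) / n) atTop (𝓝 1) := by
    have : Tendsto (fun n : ℕ => 1 + 1 / (n : ℝ)) atTop (𝓝 (1 + 0)) :=
      tendsto_one_div_atTop_nhds_zero_nat.const_add 1
    rw [add_zero] at this
    refine this.congr' ?_
    filter_upwards [eventually_ne_atTop 0] with n hn
    have : (n : ℝ) ≠ 0 := by exact_mod_cast hn
    push_cast
    field_simp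
  have h3 := (h1.mul h2).sub h
  rw [mul_one, sub_self] at h3
  refine h3.congr' ?_
  filter_upwards [eventually_ne_atTop 0] with n hn
  have : (n : ℝ) ≠ 0 := by exact_mod_cast hn
  have : ((n + 1 : ℕ) : ℝ) ≠ 0 := by positivity
  rw [Finset.sum_range_succ]
  field_simp
  ring

/-- The perpetuity series `∑ A₀ ⋯ Aₙ₋₁ Bₙ` as an extended nonnegative number. -/
noncomputable def perpetuitySeries {Ω : Type*} (A B : Ω → ℝ) (w : ℕ → Ω) : ℝ≥0∞ :=
  ∑' n, (∏ i ∈ Finset.range n, ENNReal.ofReal (A (w i))) * ENNReal.ofReal (B (w n))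

theorem measurable_perpetuitySeries {Ω : Type*} [MeasurableSpace Ω] {A B : Ω → ℝ}
    (hA : Measurable A) (hB : Measurable B) : Measurable (perpetuitySeries A B) := by
  refine Measurable.tsum fun n => ?_
  refine Measurable.mul (Finset.measurable_prod _ fun i _ => ?_) ?_ <;> fun_prop

theorem perpetuitySeries_seqCons {Ω : Type*} (A B : Ω → ℝ) (p : Ω × (ℕ → Ω)) :
    perpetuitySeries A B (seqCons p) =
      ENNReal.ofReal (A p.1) * perpetuitySeries A B p.2 + ENNReal.ofReal (B p.1) := by
  unfold perpetuitySeries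
  rw [tsum_eq_zero_add' ENNReal.summable, ← ENNReal.tsum_mul_left, add_comm]
  congr 1
  · refine tsum_congr fun n => ?_
    rw [Finset.prod_range_succ']
    simp only [seqCons_zero, seqCons_succ]
    ring
  · simp

/-- The logarithm of the `n`-th majorant is `n (m + o(1))`, eventually below `n m / 2`, so a
geometric series dominates. -/
theorem summable_of_log_growth {a b la lb : ℕ → ℝ} {m : ℝ} (hm : m < 0)
    (ha : ∀ n, 0 ≤ a n ∧ a n ≤ Real.exp (la n)) (hb : ∀ n, 0 ≤ b n ∧ b n ≤ Real.exp (lb n))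
    (hla : Tendsto (fun n : ℕ => (∑ i ∈ Finset.range n, la i) / n) atTop (𝓝 m))
    (hlb : Tendsto (fun n : ℕ => lb n / n) atTop (𝓝 0)) :
    Summable fun n => (∏ i ∈ Finset.range n, a i) * b n := by
  have hsum := hla.add hlb
  rw [add_zero] at hsum
  have hgeo : Summable fun n : ℕ => Real.exp (m / 2) ^ n :=
    summable_geometric_of_lt_one (Real.exp_pos _).le (Real.exp_lt_one_iff.2 (by linarith))
  refine Summable.of_norm_bounded_eventually_nat hgeo ?_
  filter_upwards [hsum.eventually (gt_mem_nhds (show m < m / 2 by linarith)),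
    eventually_gt_atTop 0] with n hn hn0
  have hn' : (0 : ℝ) < n := by exact_mod_cast hn0
  rw [← add_div, div_lt_iff₀ hn'] at hn
  rw [Real.norm_of_nonneg (mul_nonneg (Finset.prod_nonneg fun i _ => (ha i).1) (hb n).1)]
  calc _ ≤ (∏ i ∈ Finset.range n, Real.exp (la i)) * Real.exp (lb n) := by
        refine mul_le_mul (Finset.prod_le_prod (fun i _ => (ha i).1) fun i _ => (ha i).2) (hb n).2
          (hb n).1 (Finset.prod_nonneg fun i _ => (Real.exp_pos _).le)
    _ = Real.exp (∑ i ∈ Finset.range n, la i + lb n) := by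
        rw [← Real.exp_sum, ← Real.exp_add]
    _ ≤ Real.exp (m / 2) ^ n := by
        rw [← Real.exp_nat_mul]
        exact Real.exp_le_exp.2 (by linarith)

theorem perpetuitySeries_lt_top {Ω : Type*} [MeasurableSpace Ω] {μ : Measure Ω}
    [IsProbabilityMeasure μ] {A B : Ω → ℝ} (hA : Measurable A) (hB : Measurable B)
    (hA01 : ∀ᵐ ω ∂μ, 0 ≤ A ω ∧ A ω < 1) (hB0 : ∀ᵐ ω ∂μ, 0 ≤ B ω)
    (hlog : Integrable (fun ω => max (Real.log (B ω)) 0) μ) :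
    ∀ᵐ w ∂(Measure.infinitePi fun _ : ℕ => μ), perpetuitySeries A B w < ∞ := by
  -- `A` may vanish and `log A` need not be integrable; truncation at 1/2 makes the logarithm
  -- bounded and keeps it negative, while still majorising `A`.
  set la : Ω → ℝ := fun ω => Real.log (max (A ω) (1 / 2)) with hla
  set lb : Ω → ℝ := fun ω => max (Real.log (B ω)) 0 with hlb
  have hlam : Measurable la := by fun_prop
  have hlbm : Measurable lb := by fun_prop
  have hlaneg : ∀ᵐ ω ∂μ, la ω < 0 := hA01.mono fun ω hω =>
    Real.log_neg (lt_max_of_lt_right (by norm_num)) (max_lt hω.2 (by norm_num))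
  have hlai : Integrable la μ := by
    refine Integrable.of_bound hlam.aestronglyMeasurable (Real.log 2) ?_
    filter_upwards [hlaneg] with ω hω
    rw [Real.norm_of_nonpos hω.le, neg_le, ← Real.log_inv]
    refine Real.log_le_log (by norm_num) ?_
    rw [← one_div]
    exact le_max_right _ _
  have hm : ∫ ω, la ω ∂μ < 0 := integral_lt_of_ae_lt hlai hlaneg
  have hcoord : ∀ᵐ w ∂(Measure.infinitePi fun _ : ℕ => μ), ∀ n : ℕ,
      (0 ≤ A (w n) ∧ A (w n) < 1) ∧ 0 ≤ B (w n) := by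
    refine ae_all_iff.2 fun n => ?_
    exact (measurePreserving_eval_infinitePi (fun _ : ℕ => μ) n).quasiMeasurePreserving.ae
      (hA01.and hB0)
  filter_upwards [strong_law_infinitePi hlam hlai, strong_law_infinitePi hlbm hlog, hcoord]
    with w h1 h2 h3
  have hs : Summable fun n => (∏ i ∈ Finset.range n, A (w i)) * B (w n) := by
    refine summable_of_log_growth (la := fun n => la (w n)) (lb := fun n => lb (w n)) hm
      (fun n => ⟨(h3 n).1.1, ?_⟩) (fun n => ⟨(h3 n).2, ?_⟩) h1 (tendsto_div_of_tendsto_sum_div h2)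
    · rw [Real.exp_log (lt_max_of_lt_right (by norm_num))]
      exact le_max_left _ _
    · rcases (h3 n).2.eq_or_lt with h0 | h0
      · rw [← h0]; exact (Real.exp_pos _).le
      · calc B (w n) = Real.exp (Real.log (B (w n))) := (Real.exp_log h0).symm
          _ ≤ _ := Real.exp_le_exp.2 (le_max_left _ _)
  refine lt_of_eq_of_lt (tsum_congr fun n => ?_) hs.tsum_ofReal_lt_top
  rw [ENNReal.ofReal_mul (Finset.prod_nonneg fun i _ => (h3 i).1.1),
    ENNReal.ofReal_prod_of_nonneg fun i _ => (h3 i).1.1]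

/-- Existence of a nonnegative solution of `X = A X + B` in law. -/
theorem exists_isPerpetuityLaw {Ω : Type*} [MeasurableSpace Ω] {μ : Measure Ω}
    [IsProbabilityMeasure μ] {A B : Ω → ℝ} (hA : Measurable A) (hB : Measurable B)
    (hA01 : ∀ᵐ ω ∂μ, 0 ≤ A ω ∧ A ω < 1) (hB0 : ∀ᵐ ω ∂μ, 0 ≤ B ω)
    (hlog : Integrable (fun ω => max (Real.log (B ω)) 0) μ) :
    ∃ ν : ProbabilityMeasure ℝ, IsPerpetuityLaw μ A B (ν : Measure ℝ) ∧
      ∀ᵐ x ∂(ν : Measure ℝ), 0 ≤ x := by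
  set P := Measure.infinitePi fun _ : ℕ => μ
  set R : (ℕ → Ω) → ℝ := fun w => (perpetuitySeries A B w).toReal with hR
  have hRm : Measurable R := (measurable_perpetuitySeries hA hB).ennreal_toReal
  have hprob : IsProbabilityMeasure (P.map R) := Measure.isProbabilityMeasure_map hRm.aemeasurable
  refine ⟨⟨P.map R, hprob⟩, ?_, ?_⟩
  · show ((P.map R).prod μ).map (fun p : ℝ × Ω => A p.2 * p.1 + B p.2) = P.map R
    have hT : Measurable (fun p : ℝ × Ω => A p.2 * p.1 + B p.2) := by fun_prop
    conv_lhs => rw [← Measure.map_id (μ := μ)]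
    rw [Measure.map_prod_map _ _ hRm measurable_id, Measure.map_map hT (by fun_prop)]
    have e : P.map R = (P.prod μ).map (fun q => R (seqCons q.swap)) := by
      conv_lhs => rw [show P = (μ.prod P).map seqCons from (map_seqCons μ).symm]
      rw [Measure.map_map hRm measurable_seqCons, ← Measure.prod_swap,
        Measure.map_map (hRm.comp measurable_seqCons) measurable_swap]
      rfl
    rw [e]
    refine Measure.map_congr ?_
    have hfin : ∀ᵐ q ∂(P.prod μ), perpetuitySeries A B q.1 < ∞ :=
      Measure.quasiMeasurePreserving_fst.ae (perpetuitySeries_lt_top hA hB hA01 hB0 hlog)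
    have hpos : ∀ᵐ q ∂(P.prod μ), (0 ≤ A q.2 ∧ A q.2 < 1) ∧ 0 ≤ B q.2 :=
      Measure.quasiMeasurePreserving_snd.ae (hA01.and hB0)
    filter_upwards [hfin, hpos] with q h1 h2
    simp only [Function.comp, hR, Prod.map, id, perpetuitySeries_seqCons, Prod.swap]
    rw [ENNReal.toReal_add (ENNReal.mul_ne_top ENNReal.ofReal_ne_top h1.ne) ENNReal.ofReal_ne_top,
      ENNReal.toReal_mul, ENNReal.toReal_ofReal h2.1.1, ENNReal.toReal_ofReal h2.2]
  · show ∀ᵐ x ∂(P.map R), 0 ≤ x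
    rw [ae_map_iff hRm.aemeasurable measurableSet_Ici]
    exact ae_of_all _ fun w => ENNReal.toReal_nonneg

/-! ### Rates and exponential bounds -/

theorem ofReal_le_negLog_iff {p : ℝ≥0∞} {c : ℝ} (hc : 0 < c) :
    ENNReal.ofReal c ≤ negLog p ↔ p ≤ ENNReal.ofReal (Real.exp (-c)) := by
  have h1 : ENNReal.ofReal c = (c : EReal).toENNReal := by
    rw [EReal.toENNReal_of_ne_top (EReal.coe_ne_top c), EReal.toReal_coe]
  have h2 : ((-c : ℝ) : EReal) = ENNReal.log (ENNReal.ofReal (Real.exp (-c))) := by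
    rw [ENNReal.log_ofReal_of_pos (Real.exp_pos _), Real.log_exp]
  rw [negLog, h1, ← ENNReal.log_le_log_iff (x := p), ← h2]
  constructor
  · intro h
    have h3 : (c : EReal) ≤ -ENNReal.log p := by
      by_contra! h4
      refine absurd h (not_le.2 ?_)
      rcases le_total 0 (-ENNReal.log p) with h0 | h0
      · exact EReal.toENNReal_lt_toENNReal h0 h4
      · rw [EReal.toENNReal_of_nonpos h0, ← h1]
        exact ENNReal.ofReal_pos.2 hc
    rw [EReal.coe_neg]
    exact EReal.le_neg_of_le_neg h3
  · intro h
    refine EReal.toENNReal_le_toENNReal ?_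
    rw [EReal.coe_neg] at h
    exact EReal.le_neg_of_le_neg h

theorem negLog_antitone : Antitone negLog := fun _ _ h =>
  EReal.toENNReal_le_toENNReal (EReal.neg_le_neg_iff.2 (ENNReal.log_le_log h))

/-- The dictionary between limits in `[0, ∞]` and real exponential estimates. Positivity of `l` is
needed since `negLog` truncates at 0 and `m` may have mass above 1. -/
theorem ofReal_le_rate_iff {α : Type*} [MeasurableSpace α] {m : Measure α} [IsFiniteMeasure m]
    {s : Set α} {l φ : ℝ} (hl : 0 < l) (hφ : 0 < φ) :
    ENNReal.ofReal l ≤ negLog (m s) / ENNReal.ofReal φ ↔ m.real s ≤ Real.exp (-(l * φ)) := by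
  rw [ENNReal.le_div_iff_mul_le (Or.inl (by simpa using hφ)) (Or.inl ENNReal.ofReal_ne_top),
    ← ENNReal.ofReal_mul hl.le, ofReal_le_negLog_iff (mul_pos hl hφ),
    ENNReal.le_ofReal_iff_toReal_le (measure_ne_top _ _) (Real.exp_pos _).le]
  rfl

namespace RegularlyVarying

variable {ρ : ℝ} {f : ℝ → ℝ}

theorem eventually_pos (hf : RegularlyVarying ρ f) : ∀ᶠ t in atTop, 0 < f t :=
  (eventually_gt_atTop 0).mono hf.pos

theorem eventually_le_mul (hf : RegularlyVarying ρ f) {c q : ℝ} (hc : 0 < c) (hq : c ^ ρ < q) :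
    ∀ᶠ t in atTop, f (t * c) ≤ q * f t := by
  filter_upwards [(hf.ratio c hc).eventually (gt_mem_nhds hq), hf.eventually_pos] with t h1 h2
  rw [div_lt_iff₀ h2] at h1
  rw [mul_comm t]
  exact h1.le

theorem eventually_mul_le (hf : RegularlyVarying ρ f) {c q : ℝ} (hc : 0 < c) (hq : q < c ^ ρ) :
    ∀ᶠ t in atTop, q * f t ≤ f (t * c) := by
  filter_upwards [(hf.ratio c hc).eventually (lt_mem_nhds hq), hf.eventually_pos] with t h1 h2
  rw [lt_div_iff₀ h2] at h1
  rw [mul_comm t]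
  exact h1.le

end RegularlyVarying

/-! ### Deterministic functional inequalities for tails -/

/-- Lower bound for a tail satisfying `F t ≥ F (t y) p t` with `y < 1`. -/
theorem eventually_exp_le_tail {ρ : ℝ} (hρ : 0 < ρ) {f : ℝ → ℝ} (hf : RegularlyVarying ρ f)
    {F p : ℝ → ℝ} (hF : Antitone F) (hFpos : ∀ t, 0 < F t) {y : ℝ} (hy0 : 0 < y) (hy1 : y < 1)
    (hFp : ∀ᶠ t in atTop, F (t * y) * p t ≤ F t) {G L : ℝ} (hG : 0 ≤ G)
    (hp : ∀ᶠ t in atTop, Real.exp (-(G * f t)) ≤ p t) (hL : G < L * (1 - y ^ ρ)) :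
    ∀ᶠ t in atTop, Real.exp (-(L * f t)) ≤ F t := by
  have hq : 0 < 1 - y ^ ρ := sub_pos.2 (Real.rpow_lt_one hy0.le hy1 hρ)
  obtain ⟨L', hL1, hL2⟩ := exists_between ((div_lt_iff₀ hq).2 hL)
  rw [div_lt_iff₀ hq] at hL1
  have hL'pos : 0 < L' := by
    by_contra! h
    nlinarith
  have hcontr : ∀ᶠ t in atTop, L' * f (t * y) ≤ (L' - G) * f t := by
    have : y ^ ρ < (L' - G) / L' := by
      rw [lt_div_iff₀ hL'pos]
      linarith
    filter_upwards [hf.eventually_le_mul hy0 this] with t ht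
    calc L' * f (t * y) ≤ L' * ((L' - G) / L' * f t) := by gcongr
      _ = (L' - G) * f t := by field_simp
  obtain ⟨t1, ht1⟩ := eventually_atTop.1 (hFp.and (hp.and hcontr))
  set t0 := max t1 1
  have ht0 : 0 < t0 := lt_of_lt_of_le one_pos (le_max_right _ _)
  -- With `L'` strictly between `G / (1 - y ^ ρ)` and `L`, the excess `-log F - L' f` does not
  -- decrease under `t ↦ t y`. Iterating down to `[t0 y, t0]` bounds it by a constant, which `(L -
  -- L') f t` finally absorbs.
  have hstep : ∀ t, t0 ≤ t → -Real.log (F t) - L' * f t ≤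
      -Real.log (F (t * y)) - L' * f (t * y) := by
    intro t ht
    obtain ⟨h1, h2, h3⟩ := ht1 t ((le_max_left _ _).trans ht)
    have h4 : F (t * y) * Real.exp (-(G * f t)) ≤ F t :=
      (mul_le_mul_of_nonneg_left h2 (hFpos _).le).trans h1
    have h5 := Real.log_le_log (mul_pos (hFpos _) (Real.exp_pos _)) h4
    rw [Real.log_mul (hFpos _).ne' (Real.exp_pos _).ne', Real.log_exp] at h5
    linarith
  have hall : ∀ n : ℕ, ∀ t, t0 * y ≤ t → t * y ^ n ≤ t0 →
      -Real.log (F t) - L' * f t ≤ -Real.log (F t0) := by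
    intro n
    induction n with
    | zero =>
      intro t h1 h2
      simp only [pow_zero, mul_one] at h2
      have h3 := Real.log_le_log (hFpos _) (hF h2)
      have h4 := hf.pos t (lt_of_lt_of_le (mul_pos ht0 hy0) h1)
      nlinarith
    | succ n ih =>
      intro t h1 h2
      rcases le_total t t0 with h | h
      · have h3 := Real.log_le_log (hFpos _) (hF h)
        have h4 := hf.pos t (lt_of_lt_of_le (mul_pos ht0 hy0) h1)
        nlinarith
      · refine (hstep t h).trans (ih _ (by gcongr) ?_)
        rw [mul_assoc, ← pow_succ']
        exact h2
  have hbig := hf.tendsto_atTop hρ |>.eventually_ge_atTop (-Real.log (F t0) / (L - L'))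
  filter_upwards [hbig, eventually_ge_atTop t0] with t h1 h2
  have hlt : Tendsto (fun n : ℕ => t * y ^ n) atTop (𝓝 (t * 0)) :=
    (tendsto_pow_atTop_nhds_zero_of_lt_one hy0.le hy1).const_mul t
  rw [mul_zero] at hlt
  obtain ⟨n, hn⟩ := (hlt.eventually (gt_mem_nhds ht0)).exists
  have h3 := hall n t (by nlinarith) hn.le
  rw [div_le_iff₀ (by linarith)] at h1
  rw [← Real.le_log_iff_exp_le (hFpos t)]
  linarith

/-- A first upper bound for a tail satisfying `F t ≤ F (t K) + p t` with `K > 1`. -/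
theorem eventually_tail_le_of_step {ρ : ℝ} (hρ : 0 < ρ) {f : ℝ → ℝ} (hf : RegularlyVarying ρ f)
    {F p : ℝ → ℝ} (hF0 : Tendsto F atTop (𝓝 0)) {K δ : ℝ} (hK : 1 < K) (hδ : 0 < δ)
    (hFp : ∀ᶠ t in atTop, F t ≤ F (t * K) + p t)
    (hp : ∀ᶠ t in atTop, p t ≤ Real.exp (-(δ * f t))) :
    ∀ᶠ t in atTop, F t ≤ Real.exp (-(δ / 2 * f t)) := by
  have hK0 : 0 < K := by linarith
  obtain ⟨q, hq1, hq2⟩ := exists_between (Real.one_lt_rpow hK hρ)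
  have hft := hf.tendsto_atTop hρ
  have hdouble : ∀ᶠ t in atTop, 2 * Real.exp (-(δ * f (t * K))) ≤ Real.exp (-(δ * f t)) := by
    filter_upwards [hf.eventually_mul_le hK0 hq2,
      hft.eventually_ge_atTop (Real.log 2 / (δ * (q - 1)))] with t h1 h2
    rw [div_le_iff₀ (mul_pos hδ (by linarith))] at h2
    calc 2 * Real.exp (-(δ * f (t * K))) = Real.exp (Real.log 2 + -(δ * f (t * K))) := by
          rw [Real.exp_add, Real.exp_log two_pos]
      _ ≤ _ := by
          refine Real.exp_le_exp.2 ?_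
          have := mul_le_mul_of_nonneg_left h1 hδ.le
          nlinarith
  obtain ⟨t1, ht1⟩ := eventually_atTop.1 (hFp.and (hp.and hdouble))
  set t0 := max t1 1
  -- The errors along `t, t K, t K², …` sum to at most twice the first bound, because `hdouble` lets
  -- the factor 2 reproduce itself. As `n → ∞` the term `F (t * K ^ n)` vanishes; halving `δ`
  -- absorbs the 2.
  have hstep : ∀ n : ℕ, ∀ t, t0 ≤ t → F t - 2 * Real.exp (-(δ * f t)) ≤ F (t * K ^ n) := by
    intro n
    induction n with
    | zero =>
      intro t _
      have := Real.exp_pos (-(δ * f t))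
      simp only [pow_zero, mul_one]
      linarith
    | succ n ih =>
      intro t ht
      obtain ⟨h1, h2, h3⟩ := ht1 t ((le_max_left _ _).trans ht)
      have ht' : 1 ≤ t := (le_max_right _ _).trans ht
      have h4 := ih (t * K) (by nlinarith)
      rw [mul_assoc, ← pow_succ'] at h4
      linarith
  filter_upwards [eventually_ge_atTop t0, hft.eventually_ge_atTop (Real.log 2 / (δ / 2))]
    with t h1 h2
  have ht' : 0 < t := lt_of_lt_of_le one_pos ((le_max_right _ _).trans h1)
  have hlim : Tendsto (fun n : ℕ => F (t * K ^ n)) atTop (𝓝 0) :=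
    hF0.comp ((tendsto_pow_atTop_atTop_of_one_lt hK).const_mul_atTop ht')
  have h3 := ge_of_tendsto' hlim (fun n => hstep n t h1)
  rw [div_le_iff₀ (by positivity)] at h2
  calc F t ≤ 2 * Real.exp (-(δ * f t)) := by linarith
    _ = Real.exp (Real.log 2 + -(δ * f t)) := by rw [Real.exp_add, Real.exp_log two_pos]
    _ ≤ _ := Real.exp_le_exp.2 (by linarith)

theorem eventually_tail_mul_le {ρ : ℝ} {f : ℝ → ℝ} (hf : RegularlyVarying ρ f)
    {F : ℝ → ℝ} {l c y : ℝ} (hl : 0 < l) (hy : 0 < y)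
    (hF : ∀ᶠ t in atTop, F t ≤ Real.exp (-(l * f t))) (hc : c < l * y ^ ρ) :
    ∀ᶠ t in atTop, F (t * y) ≤ Real.exp (-(c * f t)) := by
  have h1 : c / l < y ^ ρ := by rwa [div_lt_iff₀ hl, mul_comm]
  filter_upwards [hf.eventually_mul_le hy h1,
    (tendsto_id.atTop_mul_const hy).eventually hF] with t h2 h3
  refine h3.trans (Real.exp_le_exp.2 (neg_le_neg ?_))
  have := mul_le_mul_of_nonneg_left h2 hl.le
  rwa [← mul_assoc, mul_div_cancel₀ _ hl.ne'] at this

theorem eventually_exp_le_exp_div {f : ℝ → ℝ} (hf : Tendsto f atTop atTop) {c m M : ℝ}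
    (hM : 0 < M) (hcm : m < c) :
    ∀ᶠ t in atTop, Real.exp (-(c * f t)) ≤ Real.exp (-(m * f t)) / M := by
  filter_upwards [hf.eventually_ge_atTop (Real.log M / (c - m))] with t ht
  rw [div_le_iff₀ (by linarith)] at ht
  rw [le_div_iff₀ hM]
  calc Real.exp (-(c * f t)) * M = Real.exp (-(c * f t) + Real.log M) := by
        rw [Real.exp_add, Real.exp_log hM]
    _ ≤ _ := Real.exp_le_exp.2 (by linarith)

/-- Improvement of an exponential rate through a discretised renewal inequality. -/
theorem eventually_tail_le_of_grid {ρ : ℝ} (hρ : 0 < ρ) {f : ℝ → ℝ} (hf : RegularlyVarying ρ f)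
    {F : ℝ → ℝ} (hF0 : ∀ t, 0 ≤ F t) {N : ℕ} {z : ℕ → ℝ} (hz : ∀ j, 0 < z j) {P : ℕ → ℝ → ℝ}
    (hrec : ∀ᶠ t in atTop, F t ≤ F (t * z N) +
      (P 0 t + ∑ j ∈ Finset.range N, F (t * z j) * P (j + 1) t))
    {γ : ℕ → ℝ} (hP : ∀ j ≤ N, ∀ᶠ t in atTop, P j t ≤ Real.exp (-(γ j * f t)))
    {l m : ℝ} (hl : 0 < l) (hF : ∀ᶠ t in atTop, F t ≤ Real.exp (-(l * f t)))
    (hmN : m < l * z N ^ ρ) (hm0 : m < γ 0)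
    (hm : ∀ j < N, m < l * z j ^ ρ + γ (j + 1)) :
    ∀ᶠ t in atTop, F t ≤ Real.exp (-(m * f t)) := by
  have hft := hf.tendsto_atTop hρ
  -- There are `N + 2` summands; since `m` is strictly below every rate, each fits into a share `1 /
  -- (N + 2)` of the target.
  have hM : (0 : ℝ) < N + 2 := by positivity
  have hterm : ∀ j ∈ Finset.range N, ∀ᶠ t in atTop,
      F (t * z j) * P (j + 1) t ≤ Real.exp (-(m * f t)) / (N + 2) := by
    intro j hj
    rw [Finset.mem_range] at hj
    obtain ⟨c, hc1, hc2⟩ := exists_between (sub_lt_iff_lt_add.2 (hm j hj))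
    filter_upwards [eventually_tail_mul_le hf hl (hz j) hF hc2, hP (j + 1) (by omega),
      eventually_exp_le_exp_div hft hM (show m < c + γ (j + 1) by linarith)] with t h1 h2 h3
    refine le_trans ?_ h3
    calc F (t * z j) * P (j + 1) t
        ≤ Real.exp (-(c * f t)) * Real.exp (-(γ (j + 1) * f t)) :=
          (mul_le_mul_of_nonneg_left h2 (hF0 _)).trans
            (mul_le_mul_of_nonneg_right h1 (Real.exp_pos _).le)
      _ = _ := by rw [← Real.exp_add]; ring_nf
  obtain ⟨c, hc1, hc2⟩ := exists_between hmN
  filter_upwards [hrec, (Filter.eventually_all_finset _).2 hterm,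
    eventually_tail_mul_le hf hl (hz N) hF hc2, eventually_exp_le_exp_div hft hM hc1,
    hP 0 (Nat.zero_le _), eventually_exp_le_exp_div hft hM hm0] with t h1 h2 h3 h4 h5 h6
  calc F t ≤ _ := h1
    _ ≤ Real.exp (-(m * f t)) / (N + 2) + (Real.exp (-(m * f t)) / (N + 2) +
        ∑ j ∈ Finset.range N, Real.exp (-(m * f t)) / (N + 2)) := by
      gcongr with j hj
      · exact h3.trans h4
      · exact h5.trans h6
      · exact h2 j hj
    _ = Real.exp (-(m * f t)) := by
      rw [Finset.sum_const, Finset.card_range, nsmul_eq_mul]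
      field_simp
      ring

/-- Induction along the reals with a uniform increment. -/
theorem of_uniform_increment {R : ℝ → Prop} (hmono : ∀ ⦃a b⦄, a ≤ b → R b → R a) {l₀ l₁ η : ℝ}
    (hη : 0 < η) (h₀ : R l₀) (hstep : ∀ l, l₀ ≤ l → l ≤ l₁ → R l → R (l + η)) : R l₁ := by
  have key : ∀ n : ℕ, R (l₀ + n * η) ∨ R l₁ := by
    intro n
    induction n with
    | zero => left; simpa using h₀
    | succ n ih =>
      rcases ih with ih | ih
      · rcases le_total l₁ (l₀ + n * η) with h | h
        · exact Or.inr (hmono h ih)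
        · left
          have := hstep _ (by nlinarith [(Nat.cast_nonneg n : (0 : ℝ) ≤ n)]) h ih
          push_cast
          rwa [add_mul, one_mul, ← add_assoc]
      · exact Or.inr ih
  obtain ⟨n, hn⟩ := exists_nat_ge ((l₁ - l₀) / η)
  rw [div_le_iff₀ hη] at hn
  rcases key n with h | h
  · exact hmono (by linarith) h
  · exact h

/-! ### The transform `φ_ρ` and its fixed points -/

theorem lambdaStar_mul_le {ρ : ℝ} (hρ : 0 < ρ) (g : ℝ≥0 → ℝ≥0∞) {y : ℝ≥0} (hy0 : 0 < y)
    (hy1 : y < 1) : lambdaStar ρ g * ENNReal.ofReal (1 - (y : ℝ) ^ ρ) ≤ g y := by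
  have hq : 0 < 1 - (y : ℝ) ^ ρ := sub_pos.2 (Real.rpow_lt_one y.2 (by exact_mod_cast hy1) hρ)
  rw [← ENNReal.le_div_iff_mul_le (Or.inl (by simpa using hq)) (Or.inl ENNReal.ofReal_ne_top)]
  exact (iInf_le _ y).trans ((iInf_le _ hy0).trans (iInf_le _ hy1))

theorem ofReal_rpow_add_ofReal_one_sub {ρ : ℝ} (hρ : 0 < ρ) {y : ℝ≥0} (hy1 : y < 1) :
    ENNReal.ofReal ((y : ℝ) ^ ρ) + ENNReal.ofReal (1 - (y : ℝ) ^ ρ) = 1 := by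
  rw [← ENNReal.ofReal_add (Real.rpow_nonneg y.coe_nonneg ρ)
    (sub_nonneg.2 (Real.rpow_le_one y.coe_nonneg (by exact_mod_cast hy1.le) hρ.le))]
  simp

theorem le_legendre_of_le_lambdaStar {ρ : ℝ} (hρ : 0 < ρ) (g : ℝ≥0 → ℝ≥0∞) {l : ℝ≥0}
    (hl : (l : ℝ≥0∞) ≤ lambdaStar ρ g) : (l : ℝ≥0∞) ≤ legendre ρ g l := by
  refine le_iInf₂ fun y hy => ?_
  rcases lt_or_ge y 1 with hy1 | hy1
  · calc (l : ℝ≥0∞) = ENNReal.ofReal ((y : ℝ) ^ ρ) * l + l * ENNReal.ofReal (1 - (y : ℝ) ^ ρ) := by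
          rw [mul_comm (l : ℝ≥0∞), ← add_mul, ofReal_rpow_add_ofReal_one_sub hρ hy1, one_mul]
      _ ≤ _ := by
          gcongr
          exact (mul_le_mul_left hl _).trans (lambdaStar_mul_le hρ g hy hy1)
  · have : 1 ≤ ENNReal.ofReal ((y : ℝ) ^ ρ) := by
      rw [ENNReal.one_le_ofReal]
      exact Real.one_le_rpow (by exact_mod_cast hy1) hρ.le
    exact (le_mul_of_one_le_left (zero_le) this).trans le_self_add

theorem exists_lt_of_lambdaStar_lt {ρ : ℝ} (hρ : 0 < ρ) {g : ℝ≥0 → ℝ≥0∞} {c : ℝ≥0∞}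
    (hc : lambdaStar ρ g < c) :
    ∃ y : ℝ≥0, 0 < y ∧ y < 1 ∧ g y < c * ENNReal.ofReal (1 - (y : ℝ) ^ ρ) := by
  simp only [lambdaStar, iInf_lt_iff] at hc
  obtain ⟨y, hy0, hy1, h⟩ := hc
  have hq : 0 < 1 - (y : ℝ) ^ ρ := sub_pos.2 (Real.rpow_lt_one y.2 (by exact_mod_cast hy1) hρ)
  refine ⟨y, hy0, hy1, ?_⟩
  rwa [ENNReal.div_lt_iff (Or.inl (by simpa using hq)) (Or.inl ENNReal.ofReal_ne_top)] at h

theorem legendre_lt_of_lambdaStar_lt {ρ : ℝ} (hρ : 0 < ρ) {g : ℝ≥0 → ℝ≥0∞} {l : ℝ≥0}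
    (hl : lambdaStar ρ g < l) : legendre ρ g l < l := by
  obtain ⟨y, hy0, hy1, h⟩ := exists_lt_of_lambdaStar_lt hρ hl
  calc legendre ρ g l ≤ ENNReal.ofReal ((y : ℝ) ^ ρ) * l + g y := iInf₂_le y hy0
    _ < ENNReal.ofReal ((y : ℝ) ^ ρ) * l + l * ENNReal.ofReal (1 - (y : ℝ) ^ ρ) :=
        ENNReal.add_lt_add_left (ENNReal.mul_ne_top ENNReal.ofReal_ne_top ENNReal.coe_ne_top) h
    _ = l := by
        rw [mul_comm (l : ℝ≥0∞), ← add_mul, ofReal_rpow_add_ofReal_one_sub hρ hy1, one_mul]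

theorem legendre_mono (ρ : ℝ) (g : ℝ≥0 → ℝ≥0∞) : Monotone (legendre ρ g) := fun a b hab =>
  iInf₂_mono fun y _ => by gcongr

/-- The upper bound is a limit from the right: `φ_ρ(l) ≤ φ_ρ(l + ε) < l + ε`, so attainment of the
infimum is not required. -/
theorem legendre_lambdaStar {ρ : ℝ} (hρ : 0 < ρ) {g : ℝ≥0 → ℝ≥0∞} {l : ℝ≥0}
    (hl : (l : ℝ≥0∞) = lambdaStar ρ g) : legendre ρ g l = l := by
  refine le_antisymm ?_ (le_legendre_of_le_lambdaStar hρ g hl.le)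
  refine ENNReal.le_of_forall_pos_le_add fun ε hε _ => ?_
  refine (legendre_mono ρ g (le_self_add : l ≤ l + ε)).trans ?_
  rw [← ENNReal.coe_add]
  refine (legendre_lt_of_lambdaStar_lt hρ ?_).le
  rw [← hl]
  exact_mod_cast lt_add_of_pos_right l hε

theorem legendre_concave (ρ : ℝ) (g : ℝ≥0 → ℝ≥0∞) {a b : ℝ≥0} (hab : a + b = 1) (l m : ℝ≥0) :
    a * legendre ρ g l + b * legendre ρ g m ≤ legendre ρ g (a * l + b * m) := by
  refine le_iInf₂ fun y hy => ?_
  have hab' : (a : ℝ≥0∞) + b = 1 := by exact_mod_cast hab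
  calc (a : ℝ≥0∞) * legendre ρ g l + b * legendre ρ g m
      ≤ a * (ENNReal.ofReal ((y : ℝ) ^ ρ) * l + g y) +
          b * (ENNReal.ofReal ((y : ℝ) ^ ρ) * m + g y) := by
        gcongr <;> exact iInf₂_le y hy
    _ = ENNReal.ofReal ((y : ℝ) ^ ρ) * (a * l + b * m) + (a + b) * g y := by ring
    _ = _ := by rw [hab', one_mul]; push_cast; rfl

/-- A fixed point `l < λ*` is a convex combination of `l₀`, with positive weight, and of a point
where `φ_ρ` is at least the identity: 0 if `l ≤ l₀`, `λ*` otherwise. Concavity then gives `φ_ρ(l) >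
l`. -/
theorem eq_lambdaStar_of_legendre_eq {ρ : ℝ} (hρ : 0 < ρ) {g : ℝ≥0 → ℝ≥0∞}
    (hadm : ∃ l₀ : ℝ≥0, 0 < l₀ ∧ (l₀ : ℝ≥0∞) < legendre ρ g l₀) (htop : lambdaStar ρ g ≠ ∞)
    {l : ℝ≥0} (hl0 : l ≠ 0) (hl : legendre ρ g l = l) : (l : ℝ≥0∞) = lambdaStar ρ g := by
  obtain ⟨l₀, hl₀, hlt⟩ := hadm
  have key : ∀ m a b : ℝ≥0, a ≠ 0 → a + b = 1 → (m : ℝ≥0∞) ≤ legendre ρ g m →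
      l = a * l₀ + b * m → False := by
    intro m a b ha hab hm h
    have h1 := legendre_concave ρ g hab l₀ m
    rw [← h, hl] at h1
    refine absurd h1 (not_le.2 ?_)
    calc (l : ℝ≥0∞) = a * l₀ + b * m := by rw [h]; push_cast; rfl
      _ < a * legendre ρ g l₀ + b * m := by
          refine ENNReal.add_lt_add_right (by finiteness) ?_
          exact (ENNReal.mul_lt_mul_iff_right (by simpa using ha) ENNReal.coe_ne_top).2 hlt
      _ ≤ _ := by gcongr
  lift lambdaStar ρ g to ℝ≥0 using htop with L hL
  rcases lt_trichotomy (l : ℝ≥0∞) L with h | h | h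
  · exfalso
    have hlL : l < L := by exact_mod_cast h
    rcases le_or_gt l l₀ with h1 | h1
    · refine key 0 (l / l₀) (1 - l / l₀) (div_ne_zero hl0 hl₀.ne')
        (add_tsub_cancel_of_le (div_le_one_of_le₀ h1 zero_le)) zero_le ?_
      rw [div_mul_cancel₀ _ hl₀.ne', mul_zero, add_zero]
    · have hd : 0 < L - l₀ := tsub_pos_of_lt (h1.trans hlL)
      refine key L ((L - l) / (L - l₀)) ((l - l₀) / (L - l₀))
        (div_ne_zero (tsub_pos_of_lt hlL).ne' hd.ne') ?_
        (le_legendre_of_le_lambdaStar hρ g hL.le) ?_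
      · rw [← add_div, tsub_add_tsub_cancel hlL.le h1.le, div_self hd.ne']
      · have hd' : (0 : ℝ) < L - l₀ := sub_pos.2 (by exact_mod_cast h1.trans hlL)
        rw [← NNReal.coe_inj]
        push_cast [NNReal.coe_sub hlL.le, NNReal.coe_sub h1.le, NNReal.coe_sub (h1.trans hlL).le]
        field_simp
        ring
  · exact h
  · exact absurd hl (legendre_lt_of_lambdaStar_lt hρ (hL ▸ h)).ne

/-! ### Tail estimates for the perpetuity -/

theorem IsLDM.antitone {Ω : Type*} [MeasurableSpace Ω] {μ : Measure Ω} {A B : Ω → ℝ} {f : ℝ → ℝ}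
    {g : ℝ≥0 → ℝ≥0∞} (hA01 : ∀ᵐ ω ∂μ, 0 ≤ A ω ∧ A ω < 1) (hg : IsLDM μ A B f g) :
    Antitone g := by
  intro y y' hyy
  refine le_of_tendsto_of_tendsto (hg y') (hg y) ?_
  filter_upwards [eventually_gt_atTop 0] with t ht
  refine ENNReal.div_le_div_right (negLog_antitone (measure_mono_ae ?_)) _
  filter_upwards [hA01] with ω hω hmem
  refine lt_of_lt_of_le (show t < A ω * t * y + B ω from hmem) ?_
  have h1 : (y : ℝ) ≤ y' := by exact_mod_cast hyy
  have h2 : 0 ≤ A ω * t := mul_nonneg hω.1 ht.le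
  gcongr

theorem IsPerpetuityLaw.real_tail {Ω : Type*} [MeasurableSpace Ω] {μ : Measure Ω} {A B : Ω → ℝ}
    {ν : Measure ℝ} (hA : Measurable A) (hB : Measurable B)
    (h : IsPerpetuityLaw μ A B ν) (t : ℝ) :
    ν.real {x | t < x} = (ν.prod μ).real {p : ℝ × Ω | t < A p.2 * p.1 + B p.2} := by
  have hm : MeasurableSet {x : ℝ | t < x} := measurableSet_Ioi
  conv_lhs => rw [← h, map_measureReal_apply (by fun_prop) hm]
  rfl

section Tail

variable {Ω : Type*} [MeasurableSpace Ω] {μ : Measure Ω} [IsProbabilityMeasure μ] {A B : Ω → ℝ}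
  {ν : Measure ℝ} [IsProbabilityMeasure ν]

theorem IsPerpetuityLaw.mul_le_tail (hA : Measurable A) (hB : Measurable B)
    (hA01 : ∀ᵐ ω ∂μ, 0 ≤ A ω ∧ A ω < 1) (h : IsPerpetuityLaw μ A B ν) (t y : ℝ) :
    ν.real {x | t * y < x} * μ.real {ω | t < A ω * t * y + B ω} ≤ ν.real {x | t < x} := by
  rw [h.real_tail hA hB t, ← measureReal_prod_prod]
  refine ENNReal.toReal_mono (measure_ne_top _ _) (measure_mono_ae ?_)
  have hA' : ∀ᵐ p ∂(ν.prod μ), 0 ≤ A p.2 :=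
    Measure.quasiMeasurePreserving_snd.ae (hA01.mono fun _ h => h.1)
  filter_upwards [hA'] with p hp hmem
  obtain ⟨h1, h2⟩ : t * y < p.1 ∧ t < A p.2 * t * y + B p.2 := hmem
  show t < A p.2 * p.1 + B p.2
  nlinarith

theorem IsPerpetuityLaw.le_tail (hA : Measurable A) (hB : Measurable B)
    (hA01 : ∀ᵐ ω ∂μ, 0 ≤ A ω ∧ A ω < 1) (hν : ∀ᵐ x ∂ν, 0 ≤ x) (h : IsPerpetuityLaw μ A B ν)
    (t : ℝ) : μ.real {ω | t < B ω} ≤ ν.real {x | t < x} := by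
  have e : μ.real {ω | t < B ω} = (ν.prod μ).real (univ ×ˢ {ω | t < B ω}) := by
    rw [measureReal_prod_prod]; simp
  rw [h.real_tail hA hB, e]
  refine ENNReal.toReal_mono (measure_ne_top _ _) (measure_mono_ae ?_)
  have hA' : ∀ᵐ p ∂(ν.prod μ), 0 ≤ A p.2 :=
    Measure.quasiMeasurePreserving_snd.ae (hA01.mono fun _ h => h.1)
  have hx : ∀ᵐ p ∂(ν.prod μ), 0 ≤ p.1 := Measure.quasiMeasurePreserving_fst.ae hν
  filter_upwards [hA', hx] with p hp hp' hmem
  have h2 : t < B p.2 := hmem.2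
  show t < A p.2 * p.1 + B p.2
  nlinarith

theorem IsPerpetuityLaw.tail_le_grid (hA : Measurable A) (hB : Measurable B)
    (hA01 : ∀ᵐ ω ∂μ, 0 ≤ A ω ∧ A ω < 1) (h : IsPerpetuityLaw μ A B ν) (t : ℝ) (z : ℕ → ℝ) (N : ℕ) :
    ν.real {x | t < x} ≤ ν.real {x | t * z N < x} +
      (μ.real {ω | t < A ω * t * z 0 + B ω} + ∑ j ∈ Finset.range N,
        ν.real {x | t * z j < x} * μ.real {ω | t < A ω * t * z (j + 1) + B ω}) := by
  set E : ℕ → Set Ω := fun j => {ω | t < A ω * t * z j + B ω}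
  set S : ℝ → Set ℝ := fun s => {x | s < x}
  have e1 : ∀ s, ν.real (S s) = (ν.prod μ).real (S s ×ˢ (univ : Set Ω)) := fun s => by
    rw [measureReal_prod_prod]; simp
  have e2 : μ.real (E 0) = (ν.prod μ).real ((univ : Set ℝ) ×ˢ E 0) := by
    rw [measureReal_prod_prod]; simp
  have hA' : ∀ᵐ p ∂(ν.prod μ), 0 ≤ A p.2 :=
    Measure.quasiMeasurePreserving_snd.ae (hA01.mono fun _ h => h.1)
  have hcover : (ν.prod μ).real {p : ℝ × Ω | t < A p.2 * p.1 + B p.2} ≤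
      (ν.prod μ).real ((S (t * z N) ×ˢ (univ : Set Ω)) ∪ (((univ : Set ℝ) ×ˢ E 0) ∪
        ⋃ j ∈ Finset.range N, S (t * z j) ×ˢ E (j + 1))) := by
    refine ENNReal.toReal_mono (measure_ne_top _ _) (measure_mono_ae ?_)
    filter_upwards [hA'] with p hp hmem
    have hmem' : t < A p.2 * p.1 + B p.2 := hmem
    by_cases hN : t * z N < p.1
    · exact Or.inl ⟨hN, trivial⟩
    right
    -- The first index with `p.1 ≤ t * z j` selects the cell, so `z` need not be monotone.
    have hex : ∃ j, p.1 ≤ t * z j := ⟨N, not_lt.1 hN⟩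
    classical
    have hE : p.2 ∈ E (Nat.find hex) := by
      show t < A p.2 * t * z (Nat.find hex) + B p.2
      have := Nat.find_spec hex
      nlinarith
    have hle : Nat.find hex ≤ N := Nat.find_min' hex (not_lt.1 hN)
    rcases hj : Nat.find hex with _ | j
    · rw [hj] at hE
      exact Or.inl ⟨trivial, hE⟩
    · rw [hj] at hE hle
      refine Or.inr (mem_iUnion₂.2 ⟨j, Finset.mem_range.2 hle, ?_, hE⟩)
      exact not_le.1 (Nat.find_min hex (show j < Nat.find hex by omega))
  rw [h.real_tail hA hB]
  refine hcover.trans ((measureReal_union_le _ _).trans ?_)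
  refine add_le_add (e1 _).ge ((measureReal_union_le _ _).trans (add_le_add e2.ge ?_))
  refine (measureReal_biUnion_finset_le _ _).trans (Finset.sum_le_sum fun j _ => ?_)
  rw [measureReal_prod_prod]

variable {f : ℝ → ℝ} {g : ℝ≥0 → ℝ≥0∞} {ρ : ℝ}

theorem IsLDM.eventually_le_exp (hf : RegularlyVarying ρ f) (hg : IsLDM μ A B f g) {y : ℝ≥0} {γ : ℝ}
    (hγ : 0 < γ) (hγg : ENNReal.ofReal γ < g y) :
    ∀ᶠ t in atTop, μ.real {ω | t < A ω * t * y + B ω} ≤ Real.exp (-(γ * f t)) := by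
  filter_upwards [(hg y).eventually (lt_mem_nhds hγg), hf.eventually_pos] with t h1 h2
  exact (ofReal_le_rate_iff hγ h2).1 h1.le

theorem IsLDM.eventually_exp_lt (hf : RegularlyVarying ρ f) (hg : IsLDM μ A B f g) {y : ℝ≥0} {γ : ℝ}
    (hγ : 0 < γ) (hγg : g y < ENNReal.ofReal γ) :
    ∀ᶠ t in atTop, Real.exp (-(γ * f t)) < μ.real {ω | t < A ω * t * y + B ω} := by
  filter_upwards [(hg y).eventually (gt_mem_nhds hγg), hf.eventually_pos] with t h1 h2
  exact lt_of_not_ge fun h => absurd ((ofReal_le_rate_iff hγ h2).2 h) (not_le.2 h1)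

/-- A lower bound for the tail of the perpetuity. -/
theorem IsPerpetuityLaw.eventually_exp_le (hA : Measurable A) (hB : Measurable B)
    (hA01 : ∀ᵐ ω ∂μ, 0 ≤ A ω ∧ A ω < 1) (hρ : 0 < ρ) (hf : RegularlyVarying ρ f)
    (hg : IsLDM μ A B f g) (hν : ∀ᵐ x ∂ν, 0 ≤ x) (h : IsPerpetuityLaw μ A B ν) {L : ℝ}
    (hL0 : 0 < L) (hL : lambdaStar ρ g < ENNReal.ofReal L) :
    ∀ᶠ t in atTop, Real.exp (-(L * f t)) ≤ ν.real {x | t < x} := by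
  obtain ⟨y, hy0, hy1, hgy⟩ := exists_lt_of_lambdaStar_lt hρ hL
  have hy1' : (y : ℝ) < 1 := by exact_mod_cast hy1
  have hq : 0 < 1 - (y : ℝ) ^ ρ := sub_pos.2 (Real.rpow_lt_one y.2 hy1' hρ)
  rw [← ENNReal.ofReal_mul hL0.le] at hgy
  obtain ⟨G, hG1, hG2⟩ := ENNReal.lt_iff_exists_nnreal_btwn.1 hgy
  rw [ENNReal.lt_ofReal_iff_toReal_lt ENNReal.coe_ne_top, ENNReal.coe_toReal] at hG2
  rw [← ENNReal.ofReal_coe_nnreal] at hG1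
  have hG0 : (0 : ℝ) < G := by
    by_contra! h0
    rw [ENNReal.ofReal_of_nonpos h0] at hG1
    exact not_lt_zero hG1
  have hp := hg.eventually_exp_lt hf hG0 hG1
  -- Since `A < 1`, the event `A t y + B > t` forces `B > t (1 - y)`, so `B`, and with it `X`,
  -- exceeds every level with positive probability.
  have hpos : ∀ s, 0 < ν.real {x | s < x} := by
    intro s
    refine lt_of_lt_of_le ?_ (h.le_tail hA hB hA01 hν s)
    obtain ⟨t, ht1, ht2, ht3⟩ := (hp.and ((eventually_gt_atTop 0).and
      (eventually_ge_atTop (s / (1 - y))))).exists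
    refine lt_of_lt_of_le ((Real.exp_pos _).trans ht1)
      (ENNReal.toReal_mono (measure_ne_top _ _) (measure_mono_ae ?_))
    rw [div_le_iff₀ (by linarith)] at ht3
    filter_upwards [hA01] with ω hω hmem
    have h1 : t < A ω * t * y + B ω := hmem
    show s < B ω
    have h2 : A ω * (t * y) ≤ 1 * (t * y) := mul_le_mul_of_nonneg_right hω.2.le (by positivity)
    linarith
  refine eventually_exp_le_tail hρ hf (fun s t hst => ?_) hpos (by exact_mod_cast hy0) hy1'
    (Eventually.of_forall fun t => h.mul_le_tail hA hB hA01 t y) hG0.le (hp.mono fun _ h => h.le) hG2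
  exact measureReal_mono fun x hx => lt_of_le_of_lt hst hx

theorem tendsto_real_tail (ν : Measure ℝ) [IsFiniteMeasure ν] :
    Tendsto (fun t : ℝ => ν.real {x | t < x}) atTop (𝓝 0) := by
  have h := tendsto_measure_iInter_atTop (μ := ν) (s := fun t : ℝ => Ioi t)
    (fun _ => measurableSet_Ioi.nullMeasurableSet) (fun _ _ h => Ioi_subset_Ioi h)
    ⟨0, measure_ne_top _ _⟩
  have e : ⋂ t : ℝ, Ioi t = ∅ := by
    ext x
    simpa using ⟨x, le_rfl⟩
  rw [e, measure_empty] at h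
  exact (ENNReal.tendsto_toReal ENNReal.zero_ne_top).comp h

/-- An upper bound for the tail of the perpetuity. -/
theorem IsPerpetuityLaw.eventually_le_exp (hA : Measurable A) (hB : Measurable B)
    (hA01 : ∀ᵐ ω ∂μ, 0 ≤ A ω ∧ A ω < 1) (hρ : 0 < ρ) (hf : RegularlyVarying ρ f)
    (hg : IsLDM μ A B f g) (h : IsPerpetuityLaw μ A B ν) {K : ℝ≥0} (hK : 1 < K) (hgK : 0 < g K)
    {l₁ : ℝ} (hl₁ : 0 < l₁) (hlt : ENNReal.ofReal l₁ < lambdaStar ρ g) :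
    ∀ᶠ t in atTop, ν.real {x | t < x} ≤ Real.exp (-(l₁ * f t)) := by
  have hanti := hg.antitone hA01
  obtain ⟨l', hl'1, hl'2⟩ := ENNReal.lt_iff_exists_nnreal_btwn.1 hlt
  rw [ENNReal.ofReal_lt_coe_iff hl₁.le] at hl'1
  have hl' : (0 : ℝ) < l' := hl₁.trans hl'1
  obtain ⟨δ, hδ1, hδ2⟩ := ENNReal.lt_iff_exists_nnreal_btwn.1 hgK
  have hδ : (0 : ℝ) < δ := by exact_mod_cast hδ1
  have hK' : (1 : ℝ) < K := by exact_mod_cast hK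
  set R : ℝ → Prop := fun l => ∀ᶠ t in atTop, ν.real {x | t < x} ≤ Real.exp (-(l * f t))
  have hmono : ∀ ⦃a b⦄, a ≤ b → R b → R a := fun a b hab hb => by
    filter_upwards [hb, hf.eventually_pos] with t h1 h2
    refine h1.trans (Real.exp_le_exp.2 ?_)
    nlinarith
  have hl₀ : R (δ / 2) := by
    refine eventually_tail_le_of_step hρ hf (tendsto_real_tail ν) hK' hδ
      (Eventually.of_forall fun t => ?_)
      (hg.eventually_le_exp hf (y := K) hδ (by rwa [ENNReal.ofReal_coe_nnreal]))
    have := h.tail_le_grid hA hB hA01 t (fun _ => K) 0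
    simpa using this
  -- `κ` is the uniform gain: for `0 ≤ l ≤ l₁`, the fraction `l₁ / l'` of `γ j` already covers `l (1
  -- - z j ^ ρ)`, and the rest is at least `κ`.
  set κ : ℝ := (1 - l₁ / l') * δ
  have hκ : 0 < κ := mul_pos (sub_pos.2 ((div_lt_one hl').2 hl'1)) hδ
  have hKρ : 0 < (K : ℝ) ^ ρ - 1 := sub_pos.2 (Real.one_lt_rpow hK' hρ)
  obtain ⟨N, hN⟩ := exists_nat_gt (max (2 * l₁ / κ) (1 / ((K : ℝ) ^ ρ - 1)))
  obtain ⟨hN1, hN2⟩ := max_lt_iff.1 hN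
  have hN0 : (0 : ℝ) < N := lt_trans (by positivity) hN2
  rw [div_lt_iff₀ hκ] at hN1
  rw [div_lt_iff₀ hKρ] at hN2
  -- The powers `z j ^ ρ` are equally spaced by `1 / N` and end at `1 + 1 / N`, just above 1 but at
  -- most `K ^ ρ`.
  set z : ℕ → ℝ≥0 := fun j => (((j : ℝ≥0) + 1) / N) ^ (1 / ρ) with hz
  have hzρ : ∀ j, (z j : ℝ) ^ ρ = ((j : ℝ) + 1) / N := by
    intro j
    have : z j ^ ρ = ((j : ℝ≥0) + 1) / N := by
      rw [hz, ← NNReal.rpow_mul, one_div_mul_cancel hρ.ne', NNReal.rpow_one]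
    have := congrArg NNReal.toReal this
    push_cast at this
    exact this
  have hN0' : (0 : ℝ≥0) < N := by exact_mod_cast hN0
  have hz0 : ∀ j, 0 < z j := fun j => NNReal.rpow_pos (by positivity)
  -- The bound from `λ*` degenerates near `y = 1`; there monotonicity of `g` and `δ < g K` take
  -- over.
  set γ : ℕ → ℝ := fun j => max δ (l' * (1 - ((j : ℝ) + 1) / N)) with hγ
  have hγpos : ∀ j, 0 < γ j := fun j => lt_max_of_lt_left hδ
  have hγg : ∀ j ≤ N, ENNReal.ofReal (γ j) < g (z j) := by
    intro j hj
    have hzK : z j ≤ K := by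
      rw [← NNReal.rpow_le_rpow_iff hρ, ← NNReal.coe_le_coe, NNReal.coe_rpow, hzρ, NNReal.coe_rpow,
        div_le_iff₀ hN0]
      have : (j : ℝ) ≤ N := by exact_mod_cast hj
      linarith
    have hδz : (δ : ℝ≥0∞) < g (z j) := hδ2.trans_le (hanti hzK)
    rw [hγ]
    simp only
    rw [ENNReal.ofReal_max, ENNReal.ofReal_coe_nnreal]
    refine max_lt hδz ?_
    rcases lt_or_ge (z j) 1 with h1 | h1
    · refine lt_of_lt_of_le ?_ (lambdaStar_mul_le hρ g (hz0 j) h1)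
      rw [hzρ, ENNReal.ofReal_mul hl'.le, ENNReal.ofReal_coe_nnreal]
      have hq : 0 < 1 - (z j : ℝ) ^ ρ :=
        sub_pos.2 (Real.rpow_lt_one (z j).2 (by exact_mod_cast h1) hρ)
      rw [hzρ] at hq
      exact (ENNReal.mul_lt_mul_iff_left (by simpa using hq) ENNReal.ofReal_ne_top).2 hl'2
    · have : 1 ≤ (z j : ℝ) ^ ρ := Real.one_le_rpow (by exact_mod_cast h1) hρ.le
      rw [hzρ] at this
      rw [ENNReal.ofReal_of_nonpos (by nlinarith)]
      exact lt_of_le_of_lt (zero_le) hδz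
  have hγκ : ∀ (j : ℕ) (l : ℝ), l ≤ l₁ → 0 ≤ l → l * (1 - ((j : ℝ) + 1) / N) + κ ≤ γ j := by
    intro j l hl hl0
    have h1 : (δ : ℝ) ≤ γ j := le_max_left _ _
    have h2 : l' * (1 - ((j : ℝ) + 1) / N) ≤ γ j := le_max_right _ _
    have h3 : l * (1 - ((j : ℝ) + 1) / N) ≤ l₁ / l' * γ j := by
      rw [div_mul_eq_mul_div, le_div_iff₀ hl']
      calc l * (1 - ((j : ℝ) + 1) / N) * l' = l * (l' * (1 - ((j : ℝ) + 1) / N)) := by ring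
        _ ≤ l * γ j := mul_le_mul_of_nonneg_left h2 hl0
        _ ≤ l₁ * γ j := mul_le_mul_of_nonneg_right hl (hγpos j).le
    have h4 : κ ≤ (1 - l₁ / l') * γ j :=
      mul_le_mul_of_nonneg_left h1 (sub_pos.2 ((div_lt_one hl').2 hl'1)).le
    linarith
  -- The last cell gains `l / N ≥ δ / (2 N)` because its endpoint exceeds 1; every other cell gains
  -- `κ - l / N > κ / 2`. Halving both makes the inequalities strict.
  have hη : 0 < min ((δ : ℝ) / 2 / (2 * N)) (κ / 4) := by positivity
  refine of_uniform_increment hmono hη hl₀ fun l hl1 hl2 hRl => ?_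
  have hl0 : 0 < l := lt_of_lt_of_le (by positivity) hl1
  have hη1 := min_le_left ((δ : ℝ) / 2 / (2 * N)) (κ / 4)
  have hη2 := min_le_right ((δ : ℝ) / 2 / (2 * N)) (κ / 4)
  have hlN : l / N < κ / 2 := by
    rw [div_lt_iff₀ hN0]
    nlinarith
  refine eventually_tail_le_of_grid (z := fun j => (z j : ℝ))
    (P := fun j t => μ.real {ω | t < A ω * t * z j + B ω}) (γ := γ) (N := N) hρ hf
    (fun _ => measureReal_nonneg) (fun j => by exact_mod_cast hz0 j)
    (Eventually.of_forall fun t => h.tail_le_grid hA hB hA01 t (fun j => (z j : ℝ)) N)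
    (fun j hj => hg.eventually_le_exp hf (hγpos j) (hγg j hj)) hl0 hRl ?_ ?_ fun j hj => ?_
  · rw [hzρ]
    have e : l * (((N : ℝ) + 1) / N) = l + l / N := by field_simp
    have h1 : (δ : ℝ) / 2 / (2 * N) < l / N := by
      rw [div_lt_div_iff₀ (by positivity) hN0]
      nlinarith
    rw [e]
    linarith
  · have h1 := hγκ 0 l hl2 hl0.le
    have e : l * (1 - (((0 : ℕ) : ℝ) + 1) / N) = l - l / N := by simp; ring
    rw [e] at h1
    linarith
  · rw [hzρ]
    have h1 := hγκ (j + 1) l hl2 hl0.le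
    have e : l * (1 - (((j + 1 : ℕ) : ℝ) + 1) / N) = l - l * (((j : ℝ) + 1) / N) - l / N := by
      push_cast; ring
    rw [e] at h1
    linarith

end Tail

/-! ### Admissibility and the conclusion -/

theorem exists_one_lt_pos_of_lt_legendre {ρ : ℝ} {g : ℝ≥0 → ℝ≥0∞} {l : ℝ≥0}
    (hlt : (l : ℝ≥0∞) < legendre ρ g l) : ∃ K : ℝ≥0, 1 < K ∧ 0 < g K := by
  have hlim : Tendsto (fun y : ℝ≥0 => ENNReal.ofReal ((y : ℝ) ^ ρ) * (l : ℝ≥0∞)) (𝓝 1)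
      (𝓝 (ENNReal.ofReal (((1 : ℝ≥0) : ℝ) ^ ρ) * (l : ℝ≥0∞))) := by
    refine ENNReal.Tendsto.mul_const (ENNReal.tendsto_ofReal ?_) (Or.inr ENNReal.coe_ne_top)
    exact (NNReal.continuous_coe.tendsto 1).rpow_const (Or.inl (by simp))
  rw [NNReal.coe_one, Real.one_rpow, ENNReal.ofReal_one, one_mul] at hlim
  -- For `y` slightly above 1, `y ^ ρ * l` is still below `φ_ρ(l)`, so `g y` cannot be 0.
  have hev := (hlim.mono_left nhdsWithin_le_nhds).eventually (gt_mem_nhds hlt)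
    |>.and (self_mem_nhdsWithin (a := (1 : ℝ≥0)) (s := Ioi 1))
  obtain ⟨K, h1, h2⟩ := hev.exists
  have hK : 1 < K := h2
  refine ⟨K, hK, pos_iff_ne_zero.2 fun h0 => ?_⟩
  have h3 : legendre ρ g l ≤ ENNReal.ofReal ((K : ℝ) ^ ρ) * l + g K :=
    iInf₂_le K (zero_lt_one.trans hK)
  rw [h0, add_zero] at h3
  exact absurd h1 (not_lt.2 h3)

/-- Admissibility degenerates only if `λ* = 0`. -/
theorem exists_lt_legendre_of_lambdaStar_ne_zero {Ω : Type*} [MeasurableSpace Ω] {μ : Measure Ω}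
    {A B : Ω → ℝ} (hA01 : ∀ᵐ ω ∂μ, 0 ≤ A ω ∧ A ω < 1) {f : ℝ → ℝ} {g : ℝ≥0 → ℝ≥0∞} {ρ : ℝ}
    (hg : IsLDM μ A B f g) (hadm : Admissible ρ g) (h0 : lambdaStar ρ g ≠ 0) :
    ∃ l : ℝ≥0, 0 < l ∧ (l : ℝ≥0∞) < legendre ρ g l := by
  refine hadm.resolve_right fun hg0 => h0 ?_
  have hhalf : (2 : ℝ≥0)⁻¹ < 1 := inv_lt_one_of_one_lt₀ one_lt_two
  have hz : g (2 : ℝ≥0)⁻¹ = 0 := le_antisymm ((hg.antitone hA01 zero_le).trans hg0.le) zero_le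
  refine le_antisymm ?_ zero_le
  refine (iInf_le _ (2 : ℝ≥0)⁻¹).trans ((iInf_le _ (by simp)).trans ((iInf_le _ hhalf).trans ?_))
  rw [hz, ENNReal.zero_div]

/-- The logarithmic tail asymptotics of the perpetuity. -/
theorem IsPerpetuityLaw.expDecay {Ω : Type*} [MeasurableSpace Ω] {μ : Measure Ω}
    [IsProbabilityMeasure μ] {A B : Ω → ℝ} {ν : Measure ℝ} [IsProbabilityMeasure ν]
    {f : ℝ → ℝ} {g : ℝ≥0 → ℝ≥0∞} {ρ : ℝ} (hA : Measurable A) (hB : Measurable B)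
    (hA01 : ∀ᵐ ω ∂μ, 0 ≤ A ω ∧ A ω < 1) (hρ : 0 < ρ) (hf : RegularlyVarying ρ f)
    (hg : IsLDM μ A B f g) (hadm : Admissible ρ g) (hν : ∀ᵐ x ∂ν, 0 ≤ x)
    (h : IsPerpetuityLaw μ A B ν) : ExpDecay f ν (lambdaStar ρ g) := by
  refine ⟨hν, tendsto_order.2 ⟨fun a ha => ?_, fun b hb => ?_⟩⟩
  · obtain ⟨l₀, _, hl₀⟩ := exists_lt_legendre_of_lambdaStar_ne_zero hA01 hg hadm (zero_le.trans_lt ha).ne'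
    obtain ⟨K, hK, hgK⟩ := exists_one_lt_pos_of_lt_legendre hl₀
    obtain ⟨l, hal, hl⟩ := ENNReal.lt_iff_exists_nnreal_btwn.1 ha
    have hl0 : (0 : ℝ) < l := by exact_mod_cast zero_le.trans_lt hal
    rw [← ENNReal.ofReal_coe_nnreal] at hl hal
    filter_upwards [h.eventually_le_exp hA hB hA01 hρ hf hg hK hgK hl0 hl, hf.eventually_pos]
      with t h1 h2
    exact hal.trans_le ((ofReal_le_rate_iff hl0 h2).2 h1)
  · obtain ⟨L, hL, hLb⟩ := ENNReal.lt_iff_exists_nnreal_btwn.1 hb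
    obtain ⟨L', hL', hLL'⟩ := ENNReal.lt_iff_exists_nnreal_btwn.1 hLb
    have hL0 : (0 : ℝ) < L := by exact_mod_cast zero_le.trans_lt hL
    have hLL : (L : ℝ) < L' := by exact_mod_cast hL'
    rw [← ENNReal.ofReal_coe_nnreal] at hL hLL'
    filter_upwards [h.eventually_exp_le hA hB hA01 hρ hf hg hν hL0 hL, hf.eventually_pos] with t h1 h2
    refine lt_trans (lt_of_not_ge fun h3 => ?_) hLL'
    have h4 := (ofReal_le_rate_iff (hL0.trans hLL) h2).1 h3
    have h5 := Real.exp_le_exp.1 (h1.trans h4)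
    nlinarith

end Perpetuity

theorem theorem6p1 {Ω : Type*} [MeasurableSpace Ω] (μ : Measure Ω) [IsProbabilityMeasure μ]
    (A B : Ω → ℝ) (hA : Measurable A) (hB : Measurable B)
    (hA01 : ∀ᵐ ω ∂μ, 0 ≤ A ω ∧ A ω < 1) (hB0 : ∀ᵐ ω ∂μ, 0 ≤ B ω)
    (hAne : 0 < μ {ω | A ω ≠ 0}) (hBne : 0 < μ {ω | B ω ≠ 0})
    (hlog : Integrable (fun ω => max (Real.log (B ω)) 0) μ)
    (ρ : ℝ) (hρ : 0 < ρ) (f : ℝ → ℝ) (hf : Perpetuity.RegularlyVarying ρ f)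
    (g : ℝ≥0 → ℝ≥0∞) (hg : Perpetuity.IsLDM μ A B f g) (hadm : Perpetuity.Admissible ρ g) :
    -- existence and uniqueness of the law of the perpetuity
    (∃! ν : ProbabilityMeasure ℝ, Perpetuity.IsPerpetuityLaw μ A B (ν : Measure ℝ)) ∧
    -- its logarithmic tail asymptotics
    (∀ ν : ProbabilityMeasure ℝ, Perpetuity.IsPerpetuityLaw μ A B (ν : Measure ℝ) →
      Perpetuity.ExpDecay f (ν : Measure ℝ) (Perpetuity.lambdaStar ρ g)) ∧
    -- a finite `λ*` is a fixed point of `φ_ρ`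
    (∀ l : ℝ≥0, (l : ℝ≥0∞) = Perpetuity.lambdaStar ρ g →
      Perpetuity.legendre ρ g l = (l : ℝ≥0∞)) ∧
    -- a finite nonzero `λ*` is the only nonzero fixed point of `φ_ρ`
    (Perpetuity.lambdaStar ρ g ≠ 0 → Perpetuity.lambdaStar ρ g ≠ ∞ →
      ∀ l : ℝ≥0, l ≠ 0 → Perpetuity.legendre ρ g l = (l : ℝ≥0∞) →
        (l : ℝ≥0∞) = Perpetuity.lambdaStar ρ g) := by
  obtain ⟨ν₀, hν₀, hpos⟩ := Perpetuity.exists_isPerpetuityLaw hA hB hA01 hB0 hlog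
  have huniq : ∀ ν : ProbabilityMeasure ℝ, Perpetuity.IsPerpetuityLaw μ A B (ν : Measure ℝ) →
      ν = ν₀ := fun ν hν => by
    have e : (ν : Measure ℝ) = (ν₀ : Measure ℝ) := hν.unique hA hB hA01 hν₀
    exact Subtype.ext e
  refine ⟨⟨ν₀, hν₀, huniq⟩, fun ν hν => ?_, fun l hl => Perpetuity.legendre_lambdaStar hρ hl,
    fun h0 htop l hl0 hl => ?_⟩
  -- Nonnegativity is built into the constructed law only; uniqueness carries it to every solution.
  · obtain rfl := huniq ν hν
    exact hν.expDecay hA hB hA01 hρ hf hg hadm hpos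
  · exact Perpetuity.eq_lambdaStar_of_legendre_eq hρ
      (Perpetuity.exists_lt_legendre_of_lambdaStar_ne_zero hA01 hg hadm h0) htop hl0 hl
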